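/- A literal is a propositional atom or its negation. A process block is either a single task, or one of $\mathrm{SEQ}(B_1,\dots,B_n)$, $\mathrm{XOR}(B_1,\dots,B_n)$, $\mathrm{AND}(B_1,\dots,B_n)$ with $n>1$ distinct process blocks $B_i$. Its executions are finite sequences of tasks: a task $t$ has the single execution $\langle t\rangle$; the executions of $\mathrm{SEQ}(B_1,\dots,B_n)$ are the concatenations $\epsilon_1\cdots\epsilon_n$ with $\epsilon_i$ an execution of $B_i$; those of $\mathrm{XOR}(B_1,\dots,B_n)$ are the executions of the $B_i$; those of $\mathrm{AND}(B_1,\dots,B_n)$ are all interleavings of $\epsilon_1,\dots,\epsilon_n$ with $\epsilon_i$ an execution of $B_i$. An acyclic structured annotated process model is a process block $\mathrm{SEQ}(\mathit{start},B,\mathit{end})$, with tasks $\mathit{start}$, $\mathit{end}$ and a process block $B$, together with a function $\mathrm{ann}$ that assigns to each task a finite consistent set of literals. The trace of an execution $\langle t_1,\dots,t_n\rangle$ is the sequence of pairs $(t_1,\sigma_1),\dots,(t_n,\sigma_n)$ with $\sigma_0=\emptyset$ and $\sigma_{i+1}=(\sigma_i\setminus\{\bar l: l\in\mathrm{ann}(t_{i+1})\})\cup\mathrm{ann}(t_{i+1})$,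 where $\bar l$ is the complement of $l$. A conditional obligation consists of a type (achievement or maintenance) and three literals $r$ (requirement), $t$ (trigger), $d$ (deadline). A trace complies with it if for every $i$ with $t\in\mathrm{ann}(t_i)$ there is $j\ge i$ such that * (achievement) $r\in\sigma_j$ and $d\notin\sigma_k$ for all $i\le k<j$; * (maintenance) $d\in\sigma_j$ and $r\in\sigma_k$ for all $i\le k\le j$. A process model is fully compliant with a finite set of conditional obligations if each of its traces complies with each of the obligations. **Theorem.** The problem of deciding, given an acyclic structured annotated process model and a finite set of conditional obligations whose elements are propositional literals, whether the model is fully compliant with the obligations, is in the complexity class $\mathbf P$: there is a Turing machine that, for every process model and every finite set of obligations, written as a word over a fixed finite alphabet (the process block as a bracketed expression whose tasks are the lists of their annotated literals, followed by the list of obligations, with atoms numbered in binary), gives the correct answer within a number of steps that is polynomial in the length of this word. -/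

import Mathlib

namespace BusinessProcess

/-- A propositional literal: an atom (atoms are numbered) or its negation. -/
structure Literal where
  atom : ℕ
  positive : Bool
  deriving DecidableEq

/-- The complementary literal. -/
def Literal.compl (l : Literal) : Literal := ⟨l.atom, !l.positive⟩

/-- An annotated task. Its annotation is a finite consistent set of literals, given by listing its
elements. Distinct occurrences in a block are distinct tasks, so that the annotation function of a
process is recorded at the occurrences themselves. -/
structure Task where
  ann : List Literal
  consistent : ∀ l ∈ ann, l.compl ∉ ann

mutual
/-- Process blocks: single tasks, and `SEQ(B₁, …, Bₙ)`, `XOR(B₁, …, Bₙ)`, `AND(B₁, …, Bₙ)` with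
`n > 1`. -/
inductive Block : Type
  | task (t : Task)
  | seq (Bs : Blocks)
  | xor (Bs : Blocks)
  | and (Bs : Blocks)
/-- Finite sequences of at least two process blocks. -/
inductive Blocks : Type
  | pair (B₁ B₂ : Block)
  | cons (B : Block) (Bs : Blocks)
end

/-- `Interleaving ε₁ ε₂ ε`: the sequence `ε` is a linear extension of the disjoint union of the
sequences `ε₁` and `ε₂`. -/
inductive Interleaving {α : Type} : List α → List α → List α → Prop
  | nil : Interleaving [] [] []
  | left {t : α} {ε₁ ε₂ ε : List α} :
      Interleaving ε₁ ε₂ ε → Interleaving (t :: ε₁) ε₂ (t :: ε)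
  | right {t : α} {ε₁ ε₂ ε : List α} :
      Interleaving ε₁ ε₂ ε → Interleaving ε₁ (t :: ε₂) (t :: ε)

mutual
/-- The set of executions of a process block; an execution is a sequence of tasks. -/
def Block.exe : Block → Set (List Task)
  | .task t => {[t]}
  | .seq Bs => Bs.exeSeq
  | .xor Bs => Bs.exeXor
  | .and Bs => Bs.exeAnd
/-- Concatenations `ε₁ + ⋯ + εₙ` of executions `εᵢ` of the `i`-th block. -/
def Blocks.exeSeq : Blocks → Set (List Task)
  | .pair B₁ B₂ => {ε | ∃ ε₁ ∈ B₁.exe, ∃ ε₂ ∈ B₂.exe, ε = ε₁ ++ ε₂}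
  | .cons B Bs => {ε | ∃ ε₁ ∈ B.exe, ∃ ε₂ ∈ Bs.exeSeq, ε = ε₁ ++ ε₂}
/-- Executions of one of the blocks. -/
def Blocks.exeXor : Blocks → Set (List Task)
  | .pair B₁ B₂ => B₁.exe ∪ B₂.exe
  | .cons B Bs => B.exe ∪ Bs.exeXor
/-- Linear extensions of disjoint unions of executions `εᵢ` of the `i`-th block. -/
def Blocks.exeAnd : Blocks → Set (List Task)
  | .pair B₁ B₂ => {ε | ∃ ε₁ ∈ B₁.exe, ∃ ε₂ ∈ B₂.exe, Interleaving ε₁ ε₂ ε}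
  | .cons B Bs => {ε | ∃ ε₁ ∈ B.exe, ∃ ε₂ ∈ Bs.exeAnd, Interleaving ε₁ ε₂ ε}
end

/-- An acyclic structured annotated process model: a process block enclosed in a sequence between
a start task and an end task. -/
structure ProcessModel where
  startTask : Task
  body : Block
  endTask : Task

/-- The process block `SEQ(start, B, end)` of a process model. -/
def ProcessModel.block (P : ProcessModel) : Block :=
  .seq (.cons (.task P.startTask) (.pair P.body (.task P.endTask)))

/-- A state: the set of literals that hold. -/
abbrev State := Set Literal

/-- The update `L₁ ⊕ L₂` of a state `L₁` with a set of literals `L₂`. -/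
def State.update (L₁ L₂ : State) : State :=
  (L₁ \ {l | ∃ l' ∈ L₂, l = l'.compl}) ∪ L₂

/-- A trace: the executed tasks, each with the state that holds after its execution. -/
abbrev Trace := List (Task × State)

/-- The trace of a sequence of tasks that is executed from the state `L`. -/
def traceFrom (L : State) : List Task → Trace
  | [] => []
  | t :: ε => (t, L.update {l | l ∈ t.ann}) :: traceFrom (L.update {l | l ∈ t.ann}) ε

/-- The traces of a process model: those of its executions, from the empty state. -/
def ProcessModel.traces (P : ProcessModel) : Set Trace :=
  {θ | ∃ ε ∈ P.block.exe, θ = traceFrom ∅ ε}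

/-- The two types of obligations. -/
inductive ObligationType
  | achievement
  | maintenance

/-- A conditional obligation: its type, requirement, trigger and deadline. -/
structure Obligation where
  type : ObligationType
  requirement : Literal
  trigger : Literal
  deadline : Literal

/-- Every task annotated with the trigger `t` is followed (possibly at the same position) by a
state with `r` such that no state from the trigger on and strictly before it has `d`. -/
def CompliesAchievement (θ : Trace) (r t d : Literal) : Prop :=
  ∀ i : Fin θ.length, t ∈ (θ.get i).1.ann →
    ∃ j : Fin θ.length, i ≤ j ∧ r ∈ (θ.get j).2 ∧
      ¬ ∃ k : Fin θ.length, i ≤ k ∧ k < j ∧ d ∈ (θ.get k).2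

/-- Every task annotated with the trigger `t` is followed (possibly at the same position) by a
state with `d` such that all states from the trigger on up to and including it have `r`. -/
def CompliesMaintenance (θ : Trace) (r t d : Literal) : Prop :=
  ∀ i : Fin θ.length, t ∈ (θ.get i).1.ann →
    ∃ j : Fin θ.length, i ≤ j ∧ d ∈ (θ.get j).2 ∧
      ∀ k : Fin θ.length, i ≤ k → k ≤ j → r ∈ (θ.get k).2

/-- A trace complies with an obligation. -/
def Complies (θ : Trace) (o : Obligation) : Prop :=
  match o.type with
  | .achievement => CompliesAchievement θ o.requirement o.trigger o.deadline
  | .maintenance => CompliesMaintenance θ o.requirement o.trigger o.deadline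

/-- Full compliance of a process model with the obligations in a finite list: every trace complies
with every obligation. -/
def FullyCompliant (P : ProcessModel) (os : List Obligation) : Prop :=
  ∀ θ ∈ P.traces, ∀ o ∈ os, Complies θ o

/-! ### Instances as words over a finite alphabet -/

/-- The input alphabet: binary digits of atoms, an end mark of literals that carries the sign,
brackets around tasks and composite blocks, and a start mark of obligations. -/
inductive Symbol
  | bit (b : Bool)
  | lit (positive : Bool)
  | taskOpen
  | taskClose
  | seqOpen
  | seqClose
  | xorOpen
  | xorClose
  | andOpen
  | andClose
  | obl (achievement : Bool)
  deriving DecidableEq, Fintype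

/-- The atom in binary, then the sign. -/
def Literal.encode (l : Literal) : List Symbol :=
  (Computability.encodeNat l.atom).map Symbol.bit ++ [.lit l.positive]

/-- The literals of the annotation between brackets. -/
def Task.encode (t : Task) : List Symbol :=
  .taskOpen :: (t.ann.flatMap Literal.encode ++ [.taskClose])

mutual
/-- The bracketed expression of a process block. -/
def Block.encode : Block → List Symbol
  | .task t => t.encode
  | .seq Bs => .seqOpen :: (Bs.encode ++ [.seqClose])
  | .xor Bs => .xorOpen :: (Bs.encode ++ [.xorClose])
  | .and Bs => .andOpen :: (Bs.encode ++ [.andClose])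
/-- The expressions of the blocks, one after the other. -/
def Blocks.encode : Blocks → List Symbol
  | .pair B₁ B₂ => B₁.encode ++ B₂.encode
  | .cons B Bs => B.encode ++ Bs.encode
end

/-- The expression of the process block `SEQ(start, B, end)`. -/
def ProcessModel.encode (P : ProcessModel) : List Symbol := P.block.encode

/-- A mark for the type, then the three literals. -/
def Obligation.encode (o : Obligation) : List Symbol :=
  .obl (match o.type with
    | .achievement => true
    | .maintenance => false) ::
    (o.requirement.encode ++ o.trigger.encode ++ o.deadline.encode)

/-- An instance: the process model, then the obligations. -/
def encodeInstance (x : ProcessModel × List Obligation) : List Symbol :=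
  x.1.encode ++ x.2.flatMap Obligation.encode

/-- The decision problem `p`, with instances written as words over a finite alphabet by `enc`, is
in the class `P`: some Turing machine (with finitely many stacks for tapes) answers `p x` on input `enc x`, for every
instance `x`, within a number of steps that is polynomial in the length of `enc x`. -/
def InP {α Γ : Type} [Fintype Γ] (enc : α → List Γ) (p : α → Prop) : Prop :=
  open Classical in
  Nonempty (Turing.TM2ComputableInPolyTime enc Computability.encodeBool fun x => decide (p x))

end BusinessProcess

-- Obligations are tested one at a time. For a fixed obligation only its three literals matter, so a
-- task becomes one of 64 letters, and violation by an execution is recognised by a deterministic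
-- automaton with 16 modes (`complies_traceFrom`, `foldl_advance`). The difficulty is AND: there are
-- exponentially many interleavings, and for an arbitrary automaton no bounded amount of information
-- about the components need suffice.
--
-- What helps is monotonicity. Modes are ordered so that larger means closer to a violation;
-- transitions are monotone, and a letter keeps each status bit or overwrites it by a constant. The
-- exact run may therefore be replaced by a run of guessed lower bounds. To guarantee the status `c`
-- after a letter read in status `s`, it suffices to guarantee `c ⊓ s` before it; so lower bounds
-- only grow along the run, apart from one jump into the violated mode. A rank bounded by 11 grows
-- at each change, hence 11 changes suffice (`reached_of_le`). Conversely, a run of lower bounds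
-- that ends in a violation forces a real one (`Run.endpoint_le`).
--
-- A run with few changes is a short path of modes; the letters between two changes leave the mode
-- fixed and may be interleaved freely. So an interleaving can be read along a path iff the changes
-- can be distributed among the components such that each component can be read along the same path,
-- the changes of the other being made by its environment (`Run.exists_split`,
-- `Run.exists_interleaving`). The set of paths of length at most 11, with arbitrary start, is then
-- a homomorphic image of the set of executions in a fixed finite algebra (`profileOp_profile`,
-- `fullyCompliant_iff`).
--
-- Evaluating a bracketed expression in a fixed finite algebra needs one stack and linear time.
-- Repeating this for each obligation takes quadratic time (`reaches_halt`, `inP_of_evaluator`).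

namespace BusinessProcess

/-! ### Runs along shared paths of states -/

section Run

variable {α Q : Type}

/-- `Run T a p w`: starting in the state `a`, the word `w` is read while the state changes along the
path `p`. A change marked `true` reads a letter of `w`, a change marked `false` is made by
concurrent words; the other letters of `w` leave the state unchanged. -/
inductive Run (T : Q → α → Q → Prop) : Q → List (Q × Bool) → List α → Prop
  | nil (a : Q) : Run T a [] []
  | stay {a : Q} {x : α} {p : List (Q × Bool)} {w : List α} :
      T a x a → Run T a p w → Run T a p (x :: w)
  | own {a b : Q} {x : α} {p : List (Q × Bool)} {w : List α} :
      T a x b → Run T b p w → Run T a ((b, true) :: p) (x :: w)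
  | env {a b : Q} {p : List (Q × Bool)} {w : List α} :
      Run T b p w → Run T a ((b, false) :: p) w

/-- The state at the end of a path. -/
def endpoint : Q → List (Q × Bool) → Q
  | a, [] => a
  | _, (b, _) :: p => endpoint b p

/-- `Split p p₁ p₂`: the changes owned by `p` are distributed among `p₁` and `p₂`. -/
inductive Split : List (Q × Bool) → List (Q × Bool) → List (Q × Bool) → Prop
  | nil : Split [] [] []
  | left {b : Q} {p p₁ p₂ : List (Q × Bool)} :
      Split p p₁ p₂ → Split ((b, true) :: p) ((b, true) :: p₁) ((b, false) :: p₂)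
  | right {b : Q} {p p₁ p₂ : List (Q × Bool)} :
      Split p p₁ p₂ → Split ((b, true) :: p) ((b, false) :: p₁) ((b, true) :: p₂)
  | env {b : Q} {p p₁ p₂ : List (Q × Bool)} :
      Split p p₁ p₂ → Split ((b, false) :: p) ((b, false) :: p₁) ((b, false) :: p₂)

theorem Split.length_eq {p p₁ p₂ : List (Q × Bool)} (h : Split p p₁ p₂) :
    p₁.length = p.length ∧ p₂.length = p.length := by
  induction h <;> simp_all

variable {T : Q → α → Q → Prop}

theorem Run.append {a : Q} {p₁ p₂ : List (Q × Bool)} {u v : List α} (hu : Run T a p₁ u)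
    (hv : Run T (endpoint a p₁) p₂ v) : Run T a (p₁ ++ p₂) (u ++ v) := by
  induction hu with
  | nil => exact hv
  | stay h _ ih => exact .stay h (ih hv)
  | own h _ ih => exact .own h (ih hv)
  | env _ ih => exact .env (ih hv)

theorem Run.exists_of_append {a : Q} {p : List (Q × Bool)} {u v w : List α} (h : Run T a p w)
    (hw : w = u ++ v) :
    ∃ p₁ p₂, p = p₁ ++ p₂ ∧ Run T a p₁ u ∧ Run T (endpoint a p₁) p₂ v := by
  induction h generalizing u with
  | nil a =>
    obtain ⟨rfl, rfl⟩ := List.append_eq_nil_iff.1 hw.symm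
    exact ⟨[], [], rfl, .nil a, .nil a⟩
  | @stay a x p w hx hr ih =>
    cases u with
    | nil => subst hw; exact ⟨[], p, rfl, .nil a, .stay hx hr⟩
    | cons y u =>
      obtain ⟨rfl, rfl⟩ := List.cons.inj hw
      obtain ⟨p₁, p₂, rfl, h₁, h₂⟩ := ih rfl
      exact ⟨p₁, p₂, rfl, .stay hx h₁, h₂⟩
  | @own a b x p w hx hr ih =>
    cases u with
    | nil => subst hw; exact ⟨[], _, rfl, .nil a, .own hx hr⟩
    | cons y u =>
      obtain ⟨rfl, rfl⟩ := List.cons.inj hw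
      obtain ⟨p₁, p₂, rfl, h₁, h₂⟩ := ih rfl
      exact ⟨(b, true) :: p₁, p₂, rfl, .own hx h₁, h₂⟩
  | @env a b p w hr ih =>
    obtain ⟨p₁, p₂, rfl, h₁, h₂⟩ := ih hw
    exact ⟨(b, false) :: p₁, p₂, rfl, .env h₁, h₂⟩

/-- Each letter of `w` comes from one component. If it makes a change, that component owns the
change and the other one sees it as made by the environment. -/
theorem Run.exists_split {a : Q} {p : List (Q × Bool)} {u v w : List α} (h : Run T a p w)
    (hw : Interleaving u v w) : ∃ p₁ p₂, Split p p₁ p₂ ∧ Run T a p₁ u ∧ Run T a p₂ v := by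
  induction h generalizing u v with
  | nil a => cases hw; exact ⟨[], [], .nil, .nil a, .nil a⟩
  | stay hx _ ih =>
    cases hw with
    | left hw => obtain ⟨p₁, p₂, hs, h₁, h₂⟩ := ih hw; exact ⟨p₁, p₂, hs, .stay hx h₁, h₂⟩
    | right hw => obtain ⟨p₁, p₂, hs, h₁, h₂⟩ := ih hw; exact ⟨p₁, p₂, hs, h₁, .stay hx h₂⟩
  | own hx _ ih =>
    cases hw with
    | left hw =>
      obtain ⟨p₁, p₂, hs, h₁, h₂⟩ := ih hw; exact ⟨_, _, .left hs, .own hx h₁, .env h₂⟩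
    | right hw =>
      obtain ⟨p₁, p₂, hs, h₁, h₂⟩ := ih hw; exact ⟨_, _, .right hs, .env h₁, .own hx h₂⟩
  | env _ ih =>
    obtain ⟨p₁, p₂, hs, h₁, h₂⟩ := ih hw; exact ⟨_, _, .env hs, .env h₁, .env h₂⟩

/-- The two runs are synchronised at their common changes. Between two changes both words only read
letters that fix the state, so these can be merged in any order. -/
theorem Run.exists_interleaving {a : Q} {p p₁ p₂ : List (Q × Bool)} {u v : List α}
    (hs : Split p p₁ p₂) (hu : Run T a p₁ u) (hv : Run T a p₂ v) :
    ∃ w, Interleaving u v w ∧ Run T a p w := by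
  induction hu generalizing p p₂ v with
  | nil a =>
    cases hs
    generalize hp : ([] : List (Q × Bool)) = p at hv
    induction hv with
    | nil a => exact ⟨[], .nil, .nil a⟩
    | stay hx _ ih => obtain ⟨w, hw, hr⟩ := ih hp; exact ⟨_, .right hw, .stay hx hr⟩
    | own => simp at hp
    | env => simp at hp
  | stay hx _ ih =>
    obtain ⟨w, hw, hr⟩ := ih hs hv
    exact ⟨_, .left hw, .stay hx hr⟩
  | @own a b x p₁ u hx hr ih =>
    cases hs with
    | @left _ p _ p₂ hs =>
      -- The next letter of `u` makes the change, so `v` first reads its letters that fix `a`, until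
      -- it arrives at the matching environment change.
      generalize hq : (b, false) :: p₂ = q at hv
      induction hv with
      | nil a => simp at hq
      | stay hy _ ih' => obtain ⟨w, hw, hr⟩ := ih' hx hq; exact ⟨_, .right hw, .stay hy hr⟩
      | own => simp at hq
      | env hv =>
        simp only [List.cons.injEq, Prod.mk.injEq, and_true] at hq
        obtain ⟨rfl, rfl⟩ := hq
        obtain ⟨w, hw, hr⟩ := ih hs hv
        exact ⟨_, .left hw, .own hx hr⟩
  | @env a b p₁ u hr ih =>
    cases hs with
    | @right _ p _ p₂ hs =>
      generalize hq : (b, true) :: p₂ = q at hv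
      induction hv with
      | nil a => simp at hq
      | stay hy _ ih' => obtain ⟨w, hw, hr⟩ := ih' hq; exact ⟨_, .right hw, .stay hy hr⟩
      | own hy hv =>
        simp only [List.cons.injEq, Prod.mk.injEq, and_true] at hq
        obtain ⟨rfl, rfl⟩ := hq
        obtain ⟨w, hw, hr⟩ := ih hs hv
        exact ⟨_, .right hw, .own hy hr⟩
      | env => simp at hq
    | @env _ p _ p₂ hs =>
      generalize hq : (b, false) :: p₂ = q at hv
      induction hv with
      | nil a => simp at hq
      | stay hy _ ih' => obtain ⟨w, hw, hr⟩ := ih' hq; exact ⟨_, .right hw, .stay hy hr⟩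
      | own => simp at hq
      | env hv =>
        simp only [List.cons.injEq, Prod.mk.injEq, and_true] at hq
        obtain ⟨rfl, rfl⟩ := hq
        obtain ⟨w, hw, hr⟩ := ih hs hv
        exact ⟨_, hw, .env hr⟩

/-- Runs on tasks are thereby runs on their letters: executions are composed as words of tasks,
whereas the automaton reads letters. -/
theorem run_comap {β : Type} {f : β → α} {a : Q} {p : List (Q × Bool)} {w : List β} :
    Run (fun a y b => T a (f y) b) a p w ↔ Run T a p (w.map f) := by
  constructor
  · intro h
    induction h with
    | nil a => exact .nil a
    | stay h _ ih => exact .stay h ih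
    | own h _ ih => exact .own h ih
    | env _ ih => exact .env ih
  · generalize hv : w.map f = v
    intro h
    induction h generalizing w with
    | nil a => rw [List.map_eq_nil_iff.1 hv]; exact .nil a
    | stay h _ ih => obtain ⟨y, w, rfl, rfl, rfl⟩ := List.map_eq_cons_iff.1 hv; exact .stay h (ih rfl)
    | own h _ ih => obtain ⟨y, w, rfl, rfl, rfl⟩ := List.map_eq_cons_iff.1 hv; exact .own h (ih rfl)
    | env _ ih => exact .env (ih hv)

end Run

/-! ### Evaluation of blocks in an algebra -/

/-- The ways of composing blocks. -/
inductive Op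
  | seq
  | xor
  | and
  deriving DecidableEq

instance : Fintype Op := ⟨{.seq, .xor, .and}, fun o => by cases o <;> simp⟩

section Eval

variable {C : Type} (leaf : Task → C) (op : Op → C → C → C)

mutual
/-- The value of a block in an algebra with the operations `op`. -/
def Block.eval : Block → C
  | .task t => leaf t
  | .seq Bs => Bs.eval .seq
  | .xor Bs => Bs.eval .xor
  | .and Bs => Bs.eval .and
/-- The values of the blocks, composed by one operation. -/
def Blocks.eval : Blocks → Op → C
  | .pair B₁ B₂, o => op o B₁.eval B₂.eval
  | .cons B Bs, o => op o B.eval (Bs.eval o)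
end

/-- The executions of a composite block. -/
def Blocks.exe (Bs : Blocks) : Op → Set (List Task)
  | .seq => Bs.exeSeq
  | .xor => Bs.exeXor
  | .and => Bs.exeAnd

/-- The operation on sets of executions. -/
def exeOp : Op → Set (List Task) → Set (List Task) → Set (List Task)
  | .seq, X, Y => {ε | ∃ ε₁ ∈ X, ∃ ε₂ ∈ Y, ε = ε₁ ++ ε₂}
  | .xor, X, Y => X ∪ Y
  | .and, X, Y => {ε | ∃ ε₁ ∈ X, ∃ ε₂ ∈ Y, Interleaving ε₁ ε₂ ε}

variable {leaf op} {prof : Set (List Task) → C}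

-- Evaluation commutes with any map `prof` that is a homomorphism from sets of executions to the
-- algebra.
mutual
theorem Block.eval_eq (hleaf : ∀ t, leaf t = prof {[t]})
    (hop : ∀ o X Y, op o (prof X) (prof Y) = prof (exeOp o X Y)) :
    ∀ B : Block, B.eval leaf op = prof B.exe
  | .task t => by rw [Block.eval, Block.exe, hleaf]
  | .seq Bs => by rw [Block.eval, Block.exe, Blocks.eval_eq hleaf hop Bs]; rfl
  | .xor Bs => by rw [Block.eval, Block.exe, Blocks.eval_eq hleaf hop Bs]; rfl
  | .and Bs => by rw [Block.eval, Block.exe, Blocks.eval_eq hleaf hop Bs]; rfl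
theorem Blocks.eval_eq (hleaf : ∀ t, leaf t = prof {[t]})
    (hop : ∀ o X Y, op o (prof X) (prof Y) = prof (exeOp o X Y)) :
    ∀ (Bs : Blocks) (o : Op), Bs.eval leaf op o = prof (Bs.exe o)
  | .pair B₁ B₂, o => by
    rw [Blocks.eval, Block.eval_eq hleaf hop B₁, Block.eval_eq hleaf hop B₂, hop]
    cases o <;> simp only [exeOp, Blocks.exe, Blocks.exeSeq, Blocks.exeXor, Blocks.exeAnd]
  | .cons B Bs, o => by
    rw [Blocks.eval, Block.eval_eq hleaf hop B, Blocks.eval_eq hleaf hop Bs, hop]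
    cases o <;> simp only [exeOp, Blocks.exe, Blocks.exeSeq, Blocks.exeXor, Blocks.exeAnd]
end

end Eval

/-! ### Profiles: the finite algebra of paths of bounded length -/

section Profile

/-- Paths of bounded length, with the state in which they start. -/
abbrev PathCode (Q : Type) (n : ℕ) := {z : Q × List (Q × Bool) // z.2.length ≤ n}

instance {Q : Type} [Finite Q] (n : ℕ) : Finite (PathCode Q n) := by
  have h : Finite {l : List (Q × Bool) // l.length ≤ n} :=
    (List.finite_length_le (Q × Bool) n).to_subtype
  exact Finite.of_injective
    (fun z : PathCode Q n => (z.1.1, (⟨z.1.2, z.2⟩ : {l : List (Q × Bool) // l.length ≤ n})))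
    (fun x y hxy => by
      simp only [Prod.mk.injEq, Subtype.mk.injEq] at hxy
      exact Subtype.ext (Prod.ext hxy.1 hxy.2))

variable {α Q : Type} {n : ℕ} (T : Q → α → Q → Prop)

/-- The paths along which some word of the set can be read. -/
def profile (n : ℕ) (X : Set (List α)) : Set (PathCode Q n) :=
  {z | ∃ w ∈ X, Run T z.1.1 z.1.2 w}

/-- The operations on profiles. -/
def profileOp : Op → Set (PathCode Q n) → Set (PathCode Q n) → Set (PathCode Q n)
  | .seq, M, N => {z | ∃ y₁ ∈ M, ∃ y₂ ∈ N, y₁.1.1 = z.1.1 ∧ y₂.1.1 = endpoint z.1.1 y₁.1.2 ∧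
      z.1.2 = y₁.1.2 ++ y₂.1.2}
  | .xor, M, N => M ∪ N
  | .and, M, N => {z | ∃ y₁ ∈ M, ∃ y₂ ∈ N, y₁.1.1 = z.1.1 ∧ y₂.1.1 = z.1.1 ∧
      Split z.1.2 y₁.1.2 y₂.1.2}

/-- The bound on the length loses nothing: concatenation cuts a path into shorter ones and splitting
preserves the length. Profiles contain all start states, so the second factor can be started where
the first one ends. -/
theorem profileOp_profile (T : Q → Task → Q → Prop) (o : Op) (X Y : Set (List Task)) :
    profileOp o (profile T n X) (profile T n Y) = profile T n (exeOp o X Y) := by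
  ext ⟨⟨a, p⟩, hp⟩
  cases o with
  | seq =>
    constructor
    · rintro ⟨⟨⟨a₁, p₁⟩, hp₁⟩, ⟨u, hu, h₁⟩, ⟨⟨a₂, p₂⟩, hp₂⟩, ⟨v, hv, h₂⟩, e₁, e₂, e⟩
      dsimp only at *
      subst e₁ e₂ e
      exact ⟨_, ⟨u, hu, v, hv, rfl⟩, h₁.append h₂⟩
    · rintro ⟨_, ⟨u, hu, v, hv, rfl⟩, h⟩
      obtain ⟨p₁, p₂, e, h₁, h₂⟩ := h.exists_of_append rfl
      dsimp only at *
      subst e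
      rw [List.length_append] at hp
      exact ⟨⟨(a, p₁), by dsimp; omega⟩, ⟨u, hu, h₁⟩, ⟨(_, p₂), by dsimp; omega⟩, ⟨v, hv, h₂⟩,
        rfl, rfl, rfl⟩
  | xor =>
    constructor
    · rintro (⟨w, hw, h⟩ | ⟨w, hw, h⟩)
      exacts [⟨w, .inl hw, h⟩, ⟨w, .inr hw, h⟩]
    · rintro ⟨w, hw | hw, h⟩
      exacts [.inl ⟨w, hw, h⟩, .inr ⟨w, hw, h⟩]
  | and =>
    constructor
    · rintro ⟨⟨⟨a₁, p₁⟩, hp₁⟩, ⟨u, hu, h₁⟩, ⟨⟨a₂, p₂⟩, hp₂⟩, ⟨v, hv, h₂⟩, e₁, e₂, hs⟩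
      dsimp only at *
      subst e₁ e₂
      obtain ⟨w, hw, h⟩ := Run.exists_interleaving hs h₁ h₂
      exact ⟨w, ⟨u, hu, v, hv, hw⟩, h⟩
    · rintro ⟨w, ⟨u, hu, v, hv, hw⟩, h⟩
      obtain ⟨p₁, p₂, hs, h₁, h₂⟩ := h.exists_split hw
      exact ⟨⟨(a, p₁), hs.length_eq.1.trans_le hp⟩, ⟨u, hu, h₁⟩,
        ⟨(a, p₂), hs.length_eq.2.trans_le hp⟩, ⟨v, hv, h₂⟩,
        rfl, rfl, hs⟩

end Profile

/-! ### Obligations as automata -/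

/-- What a task does to the requirement, the trigger and the deadline of an obligation:
`x i true` says that the `i`-th literal is annotated, `x i false` that its complement is. -/
abbrev Letter := Fin 3 → Bool → Bool

/-- The requirement, the trigger and the deadline. -/
def Obligation.lit (o : Obligation) : Fin 3 → Literal := ![o.requirement, o.trigger, o.deadline]

/-- Whether an obligation is an achievement obligation. -/
def Obligation.isAchievement (o : Obligation) : Bool :=
  match o.type with
  | .achievement => true
  | .maintenance => false

/-- What a task does to the literals of an obligation. -/
def Obligation.letter (o : Obligation) (t : Task) : Letter :=
  fun i b => decide (⟨(o.lit i).atom, (o.lit i).positive == b⟩ ∈ t.ann)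

open Classical in
/-- The relevant part of a state: whether the requirement does not hold, and whether the deadline
holds (achievement) or does not hold (maintenance). -/
noncomputable def Obligation.status (o : Obligation) (L : State) : Bool × Bool :=
  (decide (o.requirement ∉ L),
    if o.isAchievement then decide (o.deadline ∈ L) else decide (o.deadline ∉ L))

/-- The change of the relevant part of a state. -/
def track (ach : Bool) (x : Letter) (s : Bool × Bool) : Bool × Bool :=
  (!x 0 true && (s.1 || x 0 false),
    if ach then x 2 true || (s.2 && !x 2 false) else !x 2 true && (s.2 || x 2 false))

/-- The status that keeps a triggered obligation unsatisfied. -/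
def waiting (ach : Bool) (s : Bool × Bool) : Bool := if ach then s.1 else s.2

/-- The status that violates a triggered obligation. -/
def failing (ach : Bool) (s : Bool × Bool) : Bool := if ach then s.1 && s.2 else s.1

/-- Whether an obligation in force is violated by the following tasks. -/
def pendingViolated (ach : Bool) : Bool × Bool → List Letter → Bool
  | _, [] => true
  | s, x :: w => failing ach (track ach x s) ||
      (waiting ach (track ach x s) && pendingViolated ach (track ach x s) w)

/-- Whether an obligation is violated by a sequence of tasks. -/
def violated (ach : Bool) : Bool × Bool → List Letter → Bool
  | _, [] => false
  | s, x :: w => (x 1 true && pendingViolated ach s (x :: w)) || violated ach (track ach x s) w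

theorem mem_update_iff {L : State} {t : Task} {l : Literal} :
    l ∈ L.update {l | l ∈ t.ann} ↔ l ∈ t.ann ∨ (l ∈ L ∧ l.compl ∉ t.ann) := by
  have h : (∃ l' ∈ {l | l ∈ t.ann}, l = l'.compl) ↔ l.compl ∈ t.ann := by
    constructor
    · rintro ⟨l', h, rfl⟩
      simpa [Literal.compl] using h
    · exact fun h => ⟨_, h, by simp [Literal.compl]⟩
  simp only [State.update, Set.mem_union, Set.mem_sdiff, Set.mem_ofPred_eq] at h ⊢
  rw [h]
  tauto

theorem Obligation.letter_true (o : Obligation) (t : Task) (i : Fin 3) :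
    o.letter t i true = decide (o.lit i ∈ t.ann) := by
  simp [Obligation.letter]

theorem Obligation.letter_false (o : Obligation) (t : Task) (i : Fin 3) :
    o.letter t i false = decide ((o.lit i).compl ∈ t.ann) := by
  rw [Obligation.letter, decide_eq_decide, Literal.compl]
  simp

theorem Obligation.status_update (o : Obligation) (L : State) (t : Task) :
    o.status (L.update {l | l ∈ t.ann}) = track o.isAchievement (o.letter t) (o.status L) := by
  have h0 : o.lit 0 = o.requirement := rfl
  have h2 : o.lit 2 = o.deadline := rfl
  have e (l : Literal) := mem_update_iff (L := L) (t := t) (l := l)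
  simp only [Obligation.status, track, Obligation.letter_true, Obligation.letter_false, h0, h2]
  by_cases h₁ : o.requirement ∈ t.ann <;> by_cases h₂ : o.requirement.compl ∈ t.ann <;>
  by_cases h₃ : o.deadline ∈ t.ann <;> by_cases h₄ : o.deadline.compl ∈ t.ann <;>
  cases o.isAchievement <;> simp [e, h₁, h₂, h₃, h₄]

-- Compliance by recursion along a trace

section Trace

variable {τ : Task × State} {θ : Trace} {r d : Literal}

/-- An achievement obligation in force is satisfied. -/
def AchievedIn (θ : Trace) (r d : Literal) : Prop :=
  ∃ j : Fin θ.length, r ∈ (θ.get j).2 ∧ ¬ ∃ k : Fin θ.length, k < j ∧ d ∈ (θ.get k).2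

/-- A maintenance obligation in force is satisfied. -/
def MaintainedIn (θ : Trace) (r d : Literal) : Prop :=
  ∃ j : Fin θ.length, d ∈ (θ.get j).2 ∧ ∀ k : Fin θ.length, k ≤ j → r ∈ (θ.get k).2

theorem achievedIn_cons :
    AchievedIn (τ :: θ) r d ↔ r ∈ τ.2 ∨ (d ∉ τ.2 ∧ AchievedIn θ r d) := by
  simp [AchievedIn, Fin.exists_fin_succ]
  tauto

theorem maintainedIn_cons :
    MaintainedIn (τ :: θ) r d ↔ r ∈ τ.2 ∧ (d ∈ τ.2 ∨ MaintainedIn θ r d) := by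
  simp [MaintainedIn, Fin.exists_fin_succ, Fin.forall_fin_succ]
  tauto

theorem compliesAchievement_cons {t : Literal} :
    CompliesAchievement (τ :: θ) r t d ↔
      (t ∈ τ.1.ann → AchievedIn (τ :: θ) r d) ∧ CompliesAchievement θ r t d := by
  simp [CompliesAchievement, AchievedIn, Fin.exists_fin_succ, Fin.forall_fin_succ]

theorem compliesMaintenance_cons {t : Literal} :
    CompliesMaintenance (τ :: θ) r t d ↔
      (t ∈ τ.1.ann → MaintainedIn (τ :: θ) r d) ∧ CompliesMaintenance θ r t d := by
  simp [CompliesMaintenance, MaintainedIn, Fin.exists_fin_succ, Fin.forall_fin_succ]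

/-- An obligation in force is satisfied. -/
def SatisfiedIn (θ : Trace) (o : Obligation) : Prop :=
  if o.isAchievement then AchievedIn θ o.requirement o.deadline
  else MaintainedIn θ o.requirement o.deadline

theorem complies_nil (o : Obligation) : Complies [] o := by
  unfold Complies
  cases o.type <;> exact fun i => i.elim0

theorem complies_cons {o : Obligation} :
    Complies (τ :: θ) o ↔ (o.trigger ∈ τ.1.ann → SatisfiedIn (τ :: θ) o) ∧ Complies θ o := by
  obtain ⟨ty, r, t, d⟩ := o
  cases ty
  · exact compliesAchievement_cons
  · exact compliesMaintenance_cons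

theorem not_satisfiedIn_nil {o : Obligation} : ¬ SatisfiedIn [] o := by
  obtain ⟨ty, r, t, d⟩ := o
  cases ty <;> rintro ⟨j, -⟩ <;> exact j.elim0

/-- Both types of obligations obey the same recursion; they differ only in which status fails and
which one waits. -/
theorem satisfiedIn_cons {o : Obligation} :
    SatisfiedIn (τ :: θ) o ↔ failing o.isAchievement (o.status τ.2) = false ∧
      (waiting o.isAchievement (o.status τ.2) = true → SatisfiedIn θ o) := by
  obtain ⟨ty, r, t, d⟩ := o
  cases ty
  · simp [SatisfiedIn, Obligation.isAchievement, achievedIn_cons, failing, waiting,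
      Obligation.status]
    tauto
  · simp [SatisfiedIn, Obligation.isAchievement, maintainedIn_cons, failing, waiting,
      Obligation.status]
    tauto

theorem satisfiedIn_traceFrom (o : Obligation) (L : State) (ε : List Task) :
    SatisfiedIn (traceFrom L ε) o ↔
      pendingViolated o.isAchievement (o.status L) (ε.map o.letter) = false := by
  induction ε generalizing L with
  | nil => simpa [traceFrom, pendingViolated] using not_satisfiedIn_nil
  | cons t ε ih =>
    simp only [traceFrom, satisfiedIn_cons, ih, List.map_cons, pendingViolated,
      o.status_update, Bool.or_eq_false_iff, Bool.and_eq_false_imp]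

theorem complies_traceFrom (o : Obligation) (L : State) (ε : List Task) :
    Complies (traceFrom L ε) o ↔
      violated o.isAchievement (o.status L) (ε.map o.letter) = false := by
  induction ε generalizing L with
  | nil => simpa [traceFrom, violated] using complies_nil o
  | cons t ε ih =>
    have h := satisfiedIn_traceFrom o L (t :: ε)
    have h1 : o.lit 1 = o.trigger := rfl
    simp only [traceFrom, List.map_cons] at h
    simp only [traceFrom, complies_cons, ih, List.map_cons, violated, h, o.status_update,
      Bool.or_eq_false_iff, Bool.and_eq_false_imp, Obligation.letter_true, decide_eq_true_eq, h1]

end Trace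

-- The automaton of an obligation and its monotonicity

/-- The states of the automaton: the relevant part of the state of the process, whether an
obligation is in force and unsatisfied, and whether an obligation has been violated. -/
abbrev Mode := (Bool × Bool) × Bool × Bool

/-- The transitions of the automaton. -/
def advance (ach : Bool) (c : Mode) (x : Letter) : Mode :=
  (track ach x c.1, waiting ach (track ach x c.1) && (x 1 true || c.2.1),
    c.2.2 || (failing ach (track ach x c.1) && (x 1 true || c.2.1)))

/-- One bit records all triggered instances at once, since they share requirement and deadline and
are thus settled by the same state. An instance still pending at the end is violated. -/
theorem foldl_advance (ach : Bool) (w : List Letter) (c : Mode) :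
    ((w.foldl (advance ach) c).2.1 || (w.foldl (advance ach) c).2.2) =
      (c.2.2 || (c.2.1 && pendingViolated ach c.1 w) || violated ach c.1 w) := by
  induction w generalizing c with
  | nil => obtain ⟨s, b, e⟩ := c; cases b <;> cases e <;> rfl
  | cons x w ih =>
    obtain ⟨s, b, e⟩ := c
    rw [List.foldl_cons, ih]
    simp only [advance, violated, pendingViolated]
    generalize failing ach (track ach x s) = f
    generalize waiting ach (track ach x s) = g
    generalize pendingViolated ach (track ach x s) w = h
    generalize violated ach (track ach x s) w = k
    generalize x 1 true = l
    revert b e f g h k l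
    decide

theorem track_mono (ach : Bool) (x : Letter) {s s' : Bool × Bool} (h : s ≤ s') :
    track ach x s ≤ track ach x s' := by
  obtain ⟨s₁, s₂⟩ := s
  obtain ⟨s₁', s₂'⟩ := s'
  simp only [track]
  generalize x 0 true = a at *
  generalize x 0 false = b at *
  generalize x 2 true = c at *
  generalize x 2 false = d at *
  rw [Prod.mk_le_mk] at h ⊢
  refine ⟨?_, ?_⟩
  · have := h.1; clear h; revert a b s₁ s₁'; decide
  · have := h.2; clear h; revert ach c d s₂ s₂'; decide

/-- In each component `track` is constant or the identity. In the first case the start is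
irrelevant, in the second `c ≤ s`. This is what makes lower bounds increase along a run. -/
theorem le_track_inf (ach : Bool) (x : Letter) {s c : Bool × Bool} (h : c ≤ track ach x s) :
    c ≤ track ach x (c ⊓ s) := by
  obtain ⟨s₁, s₂⟩ := s
  obtain ⟨c₁, c₂⟩ := c
  simp only [track, Prod.mk_inf_mk] at h ⊢
  generalize x 0 true = a at *
  generalize x 0 false = b at *
  generalize x 2 true = p at *
  generalize x 2 false = q at *
  rw [Prod.mk_le_mk] at h ⊢
  refine ⟨?_, ?_⟩
  · have := h.1; clear h; revert a b s₁ c₁; decide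
  · have := h.2; clear h; revert ach p q s₂ c₂; decide

theorem waiting_mono : ∀ (ach : Bool) {s s' : Bool × Bool}, s ≤ s' →
    waiting ach s ≤ waiting ach s' := by decide

theorem waiting_inf : ∀ (ach : Bool) (s s' : Bool × Bool),
    waiting ach (s ⊓ s') = (waiting ach s && waiting ach s') := by decide

theorem failing_mono : ∀ (ach : Bool) {s s' : Bool × Bool}, s ≤ s' →
    failing ach s ≤ failing ach s' := by decide

theorem advance_mono (ach : Bool) (x : Letter) {c c' : Mode} (h : c ≤ c') :
    advance ach c x ≤ advance ach c' x := by
  have h₁ := track_mono ach x h.1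
  have h₂ := waiting_mono ach h₁
  have h₃ := failing_mono ach h₁
  have h₄ := h.2.1
  have h₅ := h.2.2
  refine ⟨h₁, ?_, ?_⟩ <;> simp only [advance]
  · exact inf_le_inf h₂ (sup_le_sup le_rfl h₄)
  · exact sup_le_sup h₅ (inf_le_inf h₃ (sup_le_sup le_rfl h₄))

-- Runs of lower bounds with few changes

/-- A measure of progress for runs of lower bounds of the automaton. -/
def Mode.rank (c : Mode) : ℕ :=
  c.1.1.toNat + c.1.2.toNat + c.2.1.toNat + 8 * c.2.2.toNat

theorem Mode.rank_le : ∀ c : Mode, c.rank ≤ 11 := by decide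

theorem Mode.eq_or_rank_lt : ∀ {c c' : Mode}, c ≤ c' → c' = c ∨ c.rank < c'.rank := by decide

/-- Lower bounds of the automaton may be kept or be improved. -/
def Commits (ach : Bool) (c : Mode) (x : Letter) (c' : Mode) : Prop :=
  c' ≤ advance ach c x ∧ (c' = c ∨ c.rank < c'.rank)

/-- The initial mode. -/
def initialMode (ach : Bool) : Mode := ((true, !ach), false, false)

theorem Obligation.status_empty (o : Obligation) :
    o.status ∅ = (initialMode o.isAchievement).1 := by
  simp only [Obligation.status, initialMode]
  cases o.isAchievement <;> simp

/-- Some run of lower bounds that reads the word alone ends in the mode. -/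
def Reached (ach : Bool) (w : List Letter) (c : Mode) : Prop :=
  ∃ a p, a ≤ initialMode ach ∧ (∀ y ∈ p, y.2 = true) ∧ Run (Commits ach) a p w ∧
    endpoint a p = c ∧ p.length + a.rank ≤ c.rank

theorem endpoint_append {Q : Type} (a : Q) (p q : List (Q × Bool)) :
    endpoint a (p ++ q) = endpoint (endpoint a p) q := by
  induction p generalizing a with
  | nil => rfl
  | cons y p ih => exact ih y.1

/-- A step extends the path only if the mode changes, and then the increase of the rank pays for the
additional entry. -/
theorem Reached.snoc {ach : Bool} {w : List Letter} {c c' : Mode} {x : Letter}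
    (h : Reached ach w c) (hx : Commits ach c x c') : Reached ach (w ++ [x]) c' := by
  obtain ⟨a, p, ha, hp, hr, rfl, hl⟩ := h
  rcases eq_or_ne c' (endpoint a p) with rfl | hne
  · refine ⟨a, p ++ [], ha, by simpa using hp, hr.append (.stay hx (.nil _)), by simp, ?_⟩
    simpa using hl
  · have := hx.2.resolve_left hne
    refine ⟨a, p ++ [(c', true)], ha, ?_, hr.append (.own hx (.nil _)), ?_, ?_⟩
    · intro y hy
      rcases List.mem_append.1 hy with hy | hy
      · exact hp y hy
      · rw [List.mem_singleton.1 hy]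
    · rw [endpoint_append]; rfl
    · simp only [List.length_append, List.length_singleton]
      omega

/-- The pending flag survives a step only in a waiting status. This invariant supplies the side
condition on pending lower bounds in `reached_of_le`. -/
theorem foldl_advance_waiting (ach : Bool) (w : List Letter) :
    (w.foldl (advance ach) (initialMode ach)).2.1 = true →
      waiting ach (w.foldl (advance ach) (initialMode ach)).1 = true := by
  induction w using List.reverseRecOn with
  | nil => intro h; exact absurd h (by simp [initialMode])
  | append_singleton w x _ =>
    rw [List.foldl_append]
    intro h
    simp only [List.foldl_cons, List.foldl_nil, advance, Bool.and_eq_true] at h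
    exact h.1

/-- Lower bounds are chosen backwards from the target, each being the meet of the next one with the
true mode. A violation is handled by following the exact mode up to the failure and then jumping to
the violated mode with least status, which every later letter preserves. -/
theorem reached_of_le (ach : Bool) (w : List Letter) :
    (∀ c : Mode, c ≤ w.foldl (advance ach) (initialMode ach) → c.2.2 = false →
      (c.2.1 = true → waiting ach c.1 = true) → Reached ach w c) ∧
    ((w.foldl (advance ach) (initialMode ach)).2.2 = true →
      Reached ach w ((false, false), false, true)) := by
  induction w using List.reverseRecOn with
  | nil =>
    refine ⟨fun c hc _ _ => ⟨c, [], hc, by simp, .nil c, rfl, by simp⟩, fun h => ?_⟩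
    exact absurd h (by simp [initialMode])
  | append_singleton w x ih =>
    obtain ⟨ih₁, ih₂⟩ := ih
    have hw := foldl_advance_waiting ach w
    rw [List.foldl_append]
    simp only [List.foldl_cons, List.foldl_nil]
    generalize w.foldl (advance ach) (initialMode ach) = s at *
    obtain ⟨s, b, e⟩ := s
    constructor
    · rintro ⟨c, f, g⟩ ⟨hc, hf, -⟩ hg hcf
      dsimp only at *
      subst hg
      -- The meet lies below the true mode, so induction applies, and below the target, so the rank
      -- cannot drop.
      refine (ih₁ (c ⊓ s, f && b, false) ⟨inf_le_right, inf_le_right, by simp⟩ rfl ?_).snoc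
        ⟨⟨le_track_inf ach x hc, ?_, by simp⟩, Mode.eq_or_rank_lt
          ⟨inf_le_left, inf_le_left, le_rfl⟩⟩
      · simp only [Bool.and_eq_true, waiting_inf]
        exact fun h => ⟨hcf h.1, hw h.2⟩
      -- If `f` is set, then `c` waits; it lies below the status reached from `c ⊓ s`, which
      -- therefore waits too and keeps the flag.
      · have h₁ := waiting_mono ach (le_track_inf ach x hc)
        simp only [advance] at hf ⊢
        generalize waiting ach (track ach x s) = p at *
        generalize waiting ach (track ach x (c ⊓ s)) = q at *
        generalize waiting ach c = r at *
        generalize x 1 true = l at *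
        clear ih₁ ih₂ hc hw
        revert b f p q r l
        decide
    · intro h
      simp only [advance, Bool.or_eq_true] at h
      rcases h with rfl | h
      · exact (ih₂ rfl).snoc ⟨⟨⟨Bool.false_le _, Bool.false_le _⟩, by simp, by simp [advance]⟩, .inl rfl⟩
      · refine (ih₁ (s, b, false) ⟨le_rfl, le_rfl, by simp⟩ rfl hw).snoc
          ⟨⟨⟨Bool.false_le _, Bool.false_le _⟩, by simp, ?_⟩, .inr ?_⟩
        · simp only [advance, h, Bool.or_true, le_refl]
        -- The jump gives up at most three bits of rank 1 each; the weight 8 of the violation flag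
        -- outweighs them.
        · clear h ih₁ ih₂ hw
          revert s b
          decide

/-- Soundness of guessing: by monotonicity a lower bound stays below the exact mode as long as the
environment makes no change. -/
theorem Run.endpoint_le {ach : Bool} {a : Mode} {p : List (Mode × Bool)} {w : List Letter}
    (h : Run (Commits ach) a p w) (hp : ∀ y ∈ p, y.2 = true) {s : Mode} (hs : a ≤ s) :
    endpoint a p ≤ w.foldl (advance ach) s := by
  induction h generalizing s with
  | nil a => exact hs
  | stay h _ ih => exact ih hp (h.1.trans (advance_mono ach _ hs))
  | own h _ ih =>
    exact ih (fun y hy => hp y (List.mem_cons_of_mem _ hy)) (h.1.trans (advance_mono ach _ hs))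
  | env => exact absurd (hp _ List.mem_cons_self) (by simp)

-- Compliance read off from the profile

/-- Profiles of blocks. -/
abbrev Profile := Set (PathCode Mode 11)

/-- The profile of a task. -/
def taskProfile (ach : Bool) (x : Letter) : Profile := profile (Commits ach) 11 {[x]}

/-- Some word with the profile violates the obligation. -/
def Profile.Violates (ach : Bool) (N : Profile) : Prop :=
  ∃ z ∈ N, z.1.1 ≤ initialMode ach ∧ (∀ y ∈ z.1.2, y.2 = true) ∧
    ((endpoint z.1.1 z.1.2).2.1 || (endpoint z.1.1 z.1.2).2.2) = true

/-- A flag raised in a lower bound is raised in the exact mode. Conversely, the path given by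
`reached_of_le` has at most 11 changes, because no rank exceeds 11. -/
theorem violates_profile_iff (ach : Bool) (X : Set (List Letter)) :
    Profile.Violates ach (profile (Commits ach) 11 X) ↔
      ∃ w ∈ X, violated ach (initialMode ach).1 w = true := by
  have key (w : List Letter) := foldl_advance ach w (initialMode ach)
  simp only [initialMode, Bool.false_and, Bool.false_or] at key
  constructor
  · rintro ⟨z, ⟨w, hw, hr⟩, hs, hp, he⟩
    refine ⟨w, hw, ?_⟩
    have := hr.endpoint_le hp hs
    rw [initialMode, ← key]
    exact (sup_le_sup this.2.1 this.2.2) he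
  · rintro ⟨w, hw, hv⟩
    rw [initialMode, ← key] at hv
    obtain ⟨c, hc, a, p, ha, hp, hr, he, hl⟩ :
        ∃ c : Mode, (c.2.1 || c.2.2) = true ∧ Reached ach w c := by
      have h := reached_of_le ach w
      have h' := foldl_advance_waiting ach w
      simp only [initialMode] at h h'
      generalize w.foldl (advance ach) _ = s at *
      obtain ⟨s, b, e⟩ := s
      cases e with
      -- After a violation the least violated mode is the target; otherwise the exact final mode is
      -- a lower bound of itself with the pending flag set.
      | true => exact ⟨_, rfl, h.2 rfl⟩
      | false => exact ⟨_, hv, h.1 _ le_rfl rfl h'⟩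
    refine ⟨⟨(a, p), ?_⟩, ⟨w, hw, hr⟩, ha, hp, ?_⟩
    · have := c.rank_le
      dsimp only
      omega
    · rw [he]; exact hc

theorem profile_letter (o : Obligation) (X : Set (List Task)) :
    (profile (fun a t b => Commits o.isAchievement a (o.letter t) b) 11 X : Profile) =
      profile (Commits o.isAchievement) 11 ((fun ε => ε.map o.letter) '' X) := by
  ext z
  simp only [profile, run_comap, Set.mem_ofPred_eq, Set.exists_mem_image]

/-- Full compliance is decided by evaluating the block in the algebra of profiles. -/
theorem fullyCompliant_iff (P : ProcessModel) (os : List Obligation) :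
    FullyCompliant P os ↔ ∀ o ∈ os, ¬ Profile.Violates o.isAchievement
      (P.block.eval (fun t => taskProfile o.isAchievement (o.letter t)) profileOp) := by
  have key (o : Obligation) : Profile.Violates o.isAchievement
      (P.block.eval (fun t => taskProfile o.isAchievement (o.letter t)) profileOp) ↔
      ∃ ε ∈ P.block.exe, ¬ Complies (traceFrom ∅ ε) o := by
    rw [Block.eval_eq (prof := profile (fun a t b => Commits o.isAchievement a (o.letter t) b) 11)
      (fun t => by simp [taskProfile, profile_letter]) (profileOp_profile _), profile_letter,
      violates_profile_iff]
    simp [complies_traceFrom, o.status_empty]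
  simp only [key, FullyCompliant, ProcessModel.traces]
  push Not
  exact ⟨fun h o ho ε hε => h _ ⟨ε, hε, rfl⟩ o ho, fun h θ ⟨ε, hε, e⟩ o ho => e ▸ h o ho ε hε⟩

open Turing StateTransition

/-! ### The machine -/

/-- A finite algebra in which blocks are evaluated, with the values of violations. -/
structure Evaluator (C : Type) where
  leaf : Bool → Letter → C
  op : Op → C → C → C
  rejects : Bool → C → Bool

/-- The stacks: the input, the output, the unread and the read part of the process, the open
composite blocks, and the unread and the read part of the atoms of the current obligation. -/
inductive Stack
  | inp
  | out
  | proc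
  | done
  | frames
  | lit (i : Fin 3)
  | used (i : Fin 3)
  deriving DecidableEq, Fintype

/-- The alphabets of the stacks. -/
abbrev Alphabet (C : Type) : Stack → Type
  | .inp => Symbol
  | .out => Bool
  | .proc => Symbol
  | .done => Symbol
  | .frames => Op × Option C
  | .lit _ => Symbol
  | .used _ => Symbol

/-- The labels of the program. -/
inductive Label
  | split
  | main
  | load (i : Fin 3)
  | scan
  | compare
  | restore (i : Fin 3)
  | rewind
  | clear (i : Fin 3)
  | finish
  deriving DecidableEq, Fintype

/-- The finite memory of the machine. -/
structure Memory (C : Type) where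
  cur : Option Symbol
  ach : Bool
  ok : Bool
  sign : Fin 3 → Bool
  pos : Bool
  same : Fin 3 → Bool
  letter : Letter
  acc : Op × Option C

instance {C : Type} [Finite C] : Finite (Memory C) :=
  Finite.of_injective
    (fun v : Memory C => (v.cur, v.ach, v.ok, v.sign, v.pos, v.same, v.letter, v.acc))
    (fun v w h => by
      obtain ⟨⟩ := v
      obtain ⟨⟩ := w
      simpa using h)

/-- The contents of the stacks. -/
structure Store (C : Type) where
  inp : List Symbol
  out : List Bool
  proc : List Symbol
  done : List Symbol
  frames : List (Op × Option C)
  lit : Fin 3 → List Symbol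
  used : Fin 3 → List Symbol

/-- The contents of the stacks, as a function. -/
def Store.stk {C : Type} (S : Store C) : ∀ k, List (Alphabet C k)
  | .inp => S.inp
  | .out => S.out
  | .proc => S.proc
  | .done => S.done
  | .frames => S.frames
  | .lit i => S.lit i
  | .used i => S.used i

section Store

variable {C : Type} (S : Store C)

@[simp] theorem Store.stk_inp : S.stk .inp = S.inp := rfl
@[simp] theorem Store.stk_out : S.stk .out = S.out := rfl
@[simp] theorem Store.stk_proc : S.stk .proc = S.proc := rfl
@[simp] theorem Store.stk_done : S.stk .done = S.done := rfl
@[simp] theorem Store.stk_frames : S.stk .frames = S.frames := rfl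
@[simp] theorem Store.stk_lit (i : Fin 3) : S.stk (.lit i) = S.lit i := rfl
@[simp] theorem Store.stk_used (i : Fin 3) : S.stk (.used i) = S.used i := rfl

@[simp] theorem Store.update_inp (l : List Symbol) :
    Function.update S.stk .inp l = ({ S with inp := l } : Store C).stk := by
  funext k; cases k <;> rfl

@[simp] theorem Store.update_out (l : List Bool) :
    Function.update S.stk .out l = ({ S with out := l } : Store C).stk := by
  funext k; cases k <;> rfl

@[simp] theorem Store.update_proc (l : List Symbol) :
    Function.update S.stk .proc l = ({ S with proc := l } : Store C).stk := by
  funext k; cases k <;> rfl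

@[simp] theorem Store.update_done (l : List Symbol) :
    Function.update S.stk .done l = ({ S with done := l } : Store C).stk := by
  funext k; cases k <;> rfl

@[simp] theorem Store.update_frames (l : List (Op × Option C)) :
    Function.update S.stk .frames l = ({ S with frames := l } : Store C).stk := by
  funext k; cases k <;> rfl

@[simp] theorem Store.update_lit (i : Fin 3) (l : List Symbol) :
    Function.update S.stk (.lit i) l =
      ({ S with lit := Function.update S.lit i l } : Store C).stk := by
  funext k
  cases k with
  | lit j =>
    rcases eq_or_ne j i with rfl | h
    · simp
    · simp [h]
  | _ => rfl

@[simp] theorem Store.update_used (i : Fin 3) (l : List Symbol) :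
    Function.update S.stk (.used i) l =
      ({ S with used := Function.update S.used i l } : Store C).stk := by
  funext k
  cases k with
  | used j =>
    rcases eq_or_ne j i with rfl | h
    · simp
    · simp [h]
  | _ => rfl

end Store

/-- Whether a symbol is a binary digit. -/
def Symbol.isBit : Symbol → Bool
  | .bit _ => true
  | _ => false

/-- Whether a symbol starts an obligation. -/
def Symbol.isObl : Symbol → Bool
  | .obl _ => true
  | _ => false

/-- The composition whose closing bracket is given. -/
def Symbol.closes : Symbol → Option Op
  | .seqClose => some .seq
  | .xorClose => some .xor
  | .andClose => some .and
  | _ => none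

/-- Whether a symbol is the opening bracket of a composite block. -/
def Symbol.isOpen : Symbol → Bool
  | .seqOpen => true
  | .xorOpen => true
  | .andOpen => true
  | _ => false

/-- The index after the given one. -/
def nextIndex : Fin 3 → Option (Fin 3) := ![some 1, some 2, none]

section Program

variable {C : Type} (E : Evaluator C)

/-- Composes the value of a block with that of the blocks to its right. -/
def Evaluator.join : Op × Option C → Option C → Op × Option C
  | (o, some d), some c => (o, some (E.op o c d))
  | (o, none), c => (o, c)
  | a, none => a

/-- The change of memory when a symbol of a task is read. -/
def Evaluator.read (v : Memory C) : Memory C :=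
  match v.cur with
  | some .taskClose => { v with letter := fun _ _ => false }
  | some .taskOpen => { v with acc := E.join v.acc (some (E.leaf v.ach v.letter)) }
  | some (.lit b) => { v with pos := b, same := fun _ => true }
  | _ => v

/-- Compares a digit with the next digit of the `i`-th atom. -/
def compareDigit (i : Fin 3) (q : TM2.Stmt (Alphabet C) Label (Memory C)) :
    TM2.Stmt (Alphabet C) Label (Memory C) :=
  .peek (.lit i) (fun v a =>
    { v with same := (Function.update v.same i (v.same i && decide (a = v.cur))) }) <|
  .branch (fun v => v.same i)
    (.pop (.lit i) (fun v _ => v) <| .push (.used i) (fun v => v.cur.getD .taskOpen) q) q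

/-- Records whether the `i`-th atom has been read completely. -/
def recordMatch (i : Fin 3) (q : TM2.Stmt (Alphabet C) Label (Memory C)) :
    TM2.Stmt (Alphabet C) Label (Memory C) :=
  .peek (.lit i) (fun v a =>
    { v with
      letter := fun j b => v.letter j b ||
        decide (j = i ∧ v.same i = true ∧ a = none ∧ (v.sign i == v.pos) = b) }) q

/-- The initial memory. -/
def Memory.init : Memory C where
  cur := none
  ach := false
  ok := true
  sign := fun _ => false
  pos := false
  same := fun _ => false
  letter := fun _ _ => false
  acc := (.seq, none)

/-- The program. -/
def Evaluator.program : Label → TM2.Stmt (Alphabet C) Label (Memory C)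
  | .split =>
    .peek .inp (fun v a => { v with cur := a }) <|
    .branch (fun v => v.cur.all Symbol.isObl) (.goto fun _ => .main) <|
    -- The default symbol is never pushed: here and below, a branch has ensured that `cur` holds a
    -- symbol.
    .pop .inp (fun v _ => v) <| .push .proc (fun v => v.cur.getD .taskOpen) <|
    .goto fun _ => .split
  | .main =>
    .pop .inp (fun v a => { v with cur := a }) <|
    .branch (fun v => v.cur.isSome)
      (.load (fun v => { v with ach := decide (v.cur = some (.obl true)), acc := (.seq, none) }) <|
        .goto fun _ => .load 0)
      (.goto fun _ => .finish)
  | .load i =>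
    .pop .inp (fun v a => { v with cur := a }) <|
    .branch (fun v => v.cur.any Symbol.isBit)
      (.push (.lit i) (fun v => v.cur.getD .taskOpen) <| .goto fun _ => .load i)
      (.load (fun v =>
          { v with sign := (Function.update v.sign i (decide (v.cur = some (.lit true)))) }) <|
        .goto fun _ => (nextIndex i).elim .scan .load)
  | .scan =>
    .pop .proc (fun v a => { v with cur := a }) <|
    .branch (fun v => v.cur.isSome)
      (.push .done (fun v => v.cur.getD .taskOpen) <|
        .branch (fun v => (v.cur.bind Symbol.closes).isSome)
          (.push .frames (fun v => v.acc) <|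
            .load (fun v => { v with acc := ((v.cur.bind Symbol.closes).getD .seq, none) }) <|
            .goto fun _ => .scan) <|
        .branch (fun v => v.cur.any Symbol.isOpen)
          (.pop .frames (fun v a => { v with acc := E.join (a.getD (.seq, none)) v.acc.2 }) <|
            .goto fun _ => .scan) <|
        .load E.read <|
        .goto fun v => if v.cur.any (fun s => decide (s = .lit true ∨ s = .lit false))
          then .compare else .scan)
      (.load (fun v => { v with ok := v.ok && !v.acc.2.any (E.rejects v.ach) }) <|
        .goto fun _ => .rewind)
  | .compare =>
    .peek .proc (fun v a => { v with cur := a }) <|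
    .branch (fun v => v.cur.any Symbol.isBit)
      (.pop .proc (fun v _ => v) <| .push .done (fun v => v.cur.getD .taskOpen) <|
        compareDigit 0 <| compareDigit 1 <| compareDigit 2 <| .goto fun _ => .compare)
      (recordMatch 0 <| recordMatch 1 <| recordMatch 2 <| .goto fun _ => .restore 0)
  | .restore i =>
    .pop (.used i) (fun v a => { v with cur := a }) <|
    .branch (fun v => v.cur.isSome)
      (.push (.lit i) (fun v => v.cur.getD .taskOpen) <| .goto fun _ => .restore i)
      (.goto fun _ => (nextIndex i).elim .scan .restore)
  | .rewind =>
    .pop .done (fun v a => { v with cur := a }) <|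
    .branch (fun v => v.cur.isSome)
      (.push .proc (fun v => v.cur.getD .taskOpen) <| .goto fun _ => .rewind)
      (.goto fun _ => .clear 0)
  | .clear i =>
    .pop (.lit i) (fun v a => { v with cur := a }) <|
    .branch (fun v => v.cur.isSome) (.goto fun _ => .clear i)
      (.goto fun _ => (nextIndex i).elim .main .clear)
  | .finish =>
    .pop .proc (fun v a => { v with cur := a }) <|
    .branch (fun v => v.cur.isSome) (.goto fun _ => .finish) <|
    .push .out (fun v => v.ok) <| .load (fun _ => Memory.init) .halt

/-- The machine that evaluates the process for each of the obligations. -/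
noncomputable def Evaluator.machine [Finite C] : FinTM2 where
  K := Stack
  k₀ := .inp
  k₁ := .out
  Γ := Alphabet C
  Λ := Label
  main := .split
  σ := Memory C
  initialState := Memory.init
  σFin := Fintype.ofFinite _
  Γk₀Fin := inferInstanceAs (Fintype Symbol)
  m := E.program

/-! ### Runs of the machine -/

/-- A configuration. -/
def config (l : Label) (v : Memory C) (S : Store C) : TM2.Cfg (Alphabet C) Label (Memory C) :=
  ⟨some l, v, S.stk⟩

/-- The machine gets from one configuration to another in a bounded number of steps. -/
def Evaluator.Reaches (c c' : TM2.Cfg (Alphabet C) Label (Memory C)) (n : ℕ) : Prop :=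
  Nonempty (EvalsToInTime (TM2.step E.program) c (some c') n)

variable {E}

theorem Evaluator.Reaches.refl (c : TM2.Cfg (Alphabet C) Label (Memory C)) : E.Reaches c c 0 :=
  ⟨.refl _ c⟩

theorem Evaluator.Reaches.trans {c₁ c₂ c₃ : TM2.Cfg (Alphabet C) Label (Memory C)} {m n : ℕ}
    (h : E.Reaches c₁ c₂ m) (h' : E.Reaches c₂ c₃ n) : E.Reaches c₁ c₃ (m + n) :=
  ⟨add_comm m n ▸ h.some.trans _ _ _ _ _ _ h'.some⟩

theorem Evaluator.Reaches.mono {c c' : TM2.Cfg (Alphabet C) Label (Memory C)} {m n : ℕ}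
    (h : E.Reaches c c' m) (hmn : m ≤ n) : E.Reaches c c' n :=
  ⟨⟨h.some.toEvalsTo, h.some.steps_le_m.trans hmn⟩⟩

theorem Evaluator.Reaches.of_step {l : Label} {v : Memory C} {S : Store C}
    {c : TM2.Cfg (Alphabet C) Label (Memory C)} (h : TM2.stepAux (E.program l) v S.stk = c) :
    E.Reaches (config l v S) c 1 :=
  ⟨⟨⟨1, by subst h; rfl⟩, le_rfl⟩⟩

/-- The transfer reverses the process, which is then read from right to left: closing brackets
before contents, signs before digits, and the last block first, as the right-nested `Blocks.eval`
requires. -/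
theorem reaches_split {w r : List Symbol} (hw : ∀ s ∈ w, s.isObl = false)
    (hr : r.head?.all Symbol.isObl = true) (v : Memory C) (S : Store C) :
    E.Reaches (config .split v { S with inp := w ++ r })
      (config .main { v with cur := r.head? } { S with inp := r, proc := w.reverse ++ S.proc })
      (w.length + 1) := by
  induction w generalizing v S with
  | nil => exact (Evaluator.Reaches.of_step (by simp [Evaluator.program, hr, config]))
  | cons s w ih =>
    have hs := hw s List.mem_cons_self
    have := (Evaluator.Reaches.of_step (E := E) (l := .split) (v := v)
      (S := { S with inp := s :: w ++ r }) (c := config .split { v with cur := some s }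
        { S with inp := w ++ r, proc := s :: S.proc })
      (by simp [Evaluator.program, hs, config])).trans
      (ih (fun s h => hw s (List.mem_cons_of_mem _ h)) _ { S with proc := s :: S.proc })
    refine cast ?_ (this.mono (n := (s :: w).length + 1) (by simp; omega))
    simp

/-! ### Reading an obligation -/

/-- The binary digits of the atom. -/
def Literal.digits (l : Literal) : List Symbol :=
  (Computability.encodeNat l.atom).map Symbol.bit

theorem Literal.encode_eq (l : Literal) : l.encode = l.digits ++ [.lit l.positive] := rfl

theorem Literal.isBit_of_mem_digits {l : Literal} {s : Symbol} (h : s ∈ l.digits) :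
    s.isBit = true := by
  obtain ⟨b, -, rfl⟩ := List.mem_map.1 h
  rfl

theorem Literal.digits_eq_iff {l l' : Literal} : l.digits = l'.digits ↔ l.atom = l'.atom := by
  constructor
  · intro h
    have h' := List.map_injective_iff.2 (fun a b h => Symbol.bit.inj h) h
    rw [← Computability.decode_encodeNat l.atom, h', Computability.decode_encodeNat]
  · intro h
    rw [Literal.digits, h, Literal.digits]

/-- The contents of the stacks for the atoms of an obligation. -/
def Obligation.atoms (o : Obligation) (i : Fin 3) : List Symbol := (o.lit i).digits.reverse

theorem reaches_load (i : Fin 3) {w : List Symbol} (hw : ∀ s ∈ w, s.isBit = true) (b : Bool)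
    (r : List Symbol) (v : Memory C) (S : Store C) :
    E.Reaches (config (.load i) v { S with inp := w ++ .lit b :: r })
      (config ((nextIndex i).elim .scan .load)
        { v with cur := some (.lit b), sign := Function.update v.sign i b }
        { S with inp := r, lit := Function.update S.lit i (w.reverse ++ S.lit i) })
      (w.length + 1) := by
  induction w generalizing v S with
  | nil =>
    exact (Evaluator.Reaches.of_step (by
      cases b <;> simp [Evaluator.program, config, Symbol.isBit]))
  | cons s w ih =>
    have hs := hw s List.mem_cons_self
    have := (Evaluator.Reaches.of_step (E := E) (l := .load i) (v := v)
      (S := { S with inp := s :: w ++ .lit b :: r })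
      (c := config (.load i) { v with cur := some s }
        { S with inp := w ++ .lit b :: r, lit := Function.update S.lit i (s :: S.lit i) })
      (by simp [Evaluator.program, hs, config])).trans
      (ih (fun s h => hw s (List.mem_cons_of_mem _ h)) _
        { S with lit := Function.update S.lit i (s :: S.lit i) })
    refine cast ?_ (this.mono (n := (s :: w).length + 1) (by simp; omega))
    simp

/-- The contents of the stacks between two obligations. -/
def mainStore (inp proc : List Symbol) : Store C :=
  ⟨inp, [], proc, [], [], fun _ => [], fun _ => []⟩

/-- The contents of the stacks while the process is read. -/
def Obligation.scanStore (o : Obligation) (inp proc done : List Symbol)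
    (frames : List (Op × Option C)) : Store C :=
  ⟨inp, [], proc, done, frames, o.atoms, fun _ => []⟩

/-- The memory holds the obligation. -/
structure Obligation.Loaded (o : Obligation) (v : Memory C) : Prop where
  ach : v.ach = o.isAchievement
  sign : v.sign = fun i => (o.lit i).positive

theorem reaches_obligation_loaded (o : Obligation) (r proc : List Symbol) (v : Memory C) :
    ∃ v' : Memory C, E.Reaches (config .main v (mainStore (o.encode ++ r) proc))
      (config .scan v' (o.scanStore r proc [] [])) o.encode.length ∧
      o.Loaded v' ∧ v'.ok = v.ok ∧ v'.acc = (.seq, none) := by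
  obtain ⟨v₀, h₀, ha, ho, hacc⟩ : ∃ v' : Memory C,
      E.Reaches (config .main v (mainStore (o.encode ++ r) proc)) (config (.load 0) v' (mainStore
        (o.requirement.digits ++ .lit o.requirement.positive :: (o.trigger.digits ++
          .lit o.trigger.positive :: (o.deadline.digits ++ .lit o.deadline.positive :: r)))
        proc)) 1 ∧ v'.ach = o.isAchievement ∧ v'.ok = v.ok ∧ v'.acc = (.seq, none) := by
    refine ⟨{ v with
      cur := some (.obl o.isAchievement), ach := o.isAchievement, acc := (.seq, none) },
      Evaluator.Reaches.of_step ?_, rfl, rfl, rfl⟩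
    obtain ⟨ty, -, -, -⟩ := o
    cases ty <;> simp [Evaluator.program, config, mainStore, Obligation.encode,
      Obligation.isAchievement, Literal.encode_eq]
  have h (i j : Label) (k : Fin 3) (hi : i = .load k) (hj : (nextIndex k).elim .scan .load = j)
      (l : Literal) (r : List Symbol) (v : Memory C) (f g : Fin 3 → List Symbol)
      (hg : Function.update f k (l.digits.reverse ++ f k) = g) :
      E.Reaches
        (config i v ⟨l.digits ++ .lit l.positive :: r, [], proc, [], [], f, fun _ => []⟩)
        (config j
          { v with cur := some (.lit l.positive), sign := Function.update v.sign k l.positive }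
          ⟨r, [], proc, [], [], g, fun _ => []⟩)
        (l.digits.length + 1) := by
    subst hi hj hg
    exact reaches_load k (fun _ => l.isBit_of_mem_digits) _ r v
      ⟨[], [], proc, [], [], f, fun _ => []⟩
  have h₁ := h₀.trans (h _ (.load 1) 0 rfl rfl _ _ _ _ _ rfl)
  have h₂ := h₁.trans (h _ (.load 2) 1 rfl rfl _ _ _ _ _ rfl)
  have h₃ := h₂.trans (h _ .scan 2 rfl rfl _ _ _ _ o.atoms
    (by funext i; fin_cases i <;> simp [Obligation.atoms, Obligation.lit]))
  refine ⟨_, h₃.mono (n := o.encode.length) ?_, ⟨ha, ?_⟩, ho, hacc⟩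
  · simp [Obligation.encode, Literal.encode_eq]
    omega
  · funext i
    fin_cases i <;> simp [Obligation.lit]

/-! ### Comparing atoms -/

/-- The effect of a digit on the comparison with an atom: whether all digits agree, the digits of
the atom that have not been read, and those that have been read. -/
def digitStep (y : Bool × List Symbol × List Symbol) (s : Symbol) :
    Bool × List Symbol × List Symbol :=
  if y.1 = true ∧ y.2.1.head? = some s then (true, y.2.1.tail, s :: y.2.2)
  else (false, y.2.1, y.2.2)

/-- A comparison destroys nothing: the digits consumed, put back in reverse order, restore the atom.
-/
theorem foldl_digitStep_append (w : List Symbol) (y : Bool × List Symbol × List Symbol) :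
    (w.foldl digitStep y).2.2.reverse ++ (w.foldl digitStep y).2.1 = y.2.2.reverse ++ y.2.1 := by
  induction w generalizing y with
  | nil => rfl
  | cons s w ih =>
    rw [List.foldl_cons, ih, digitStep]
    split_ifs with h
    · obtain ⟨l, hl⟩ := List.head?_eq_some_iff.1 h.2
      simp [hl]
    · rfl

theorem foldl_digitStep_length (w : List Symbol) (y : Bool × List Symbol × List Symbol) :
    (w.foldl digitStep y).2.2.length ≤ y.2.2.length + w.length := by
  induction w generalizing y with
  | nil => rfl
  | cons s w ih =>
    rw [List.foldl_cons]
    refine (ih _).trans ?_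
    rw [digitStep]
    split_ifs
    · simp; omega
    · simp

/-- The emptiness condition excludes the case where the word is only a proper prefix of the stored
atom. -/
theorem foldl_digitStep_iff (w : List Symbol) (y : Bool × List Symbol × List Symbol) :
    ((w.foldl digitStep y).1 = true ∧ (w.foldl digitStep y).2.1 = []) ↔
      y.1 = true ∧ y.2.1 = w := by
  induction w generalizing y with
  | nil => rfl
  | cons s w ih =>
    rw [List.foldl_cons, ih, digitStep]
    obtain ⟨e, l, u⟩ := y
    cases l with
    | nil => simp
    | cons t l =>
      by_cases h : e = true ∧ t = s
      · simp [h]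
      · simp [h]
        tauto

/-- The state of the comparison with the `i`-th atom. -/
def comparison (v : Memory C) (S : Store C) (i : Fin 3) : Bool × List Symbol × List Symbol :=
  (v.same i, S.lit i, S.used i)

theorem stepAux_compareDigit (i : Fin 3) (q : TM2.Stmt (Alphabet C) Label (Memory C))
    {v : Memory C} {s : Symbol} (hs : v.cur = some s) (S : Store C) :
    TM2.stepAux (compareDigit i q) v S.stk = TM2.stepAux q
      { v with same := Function.update v.same i (digitStep (comparison v S i) s).1 }
      ({ S with
          lit := Function.update S.lit i (digitStep (comparison v S i) s).2.1
          used := Function.update S.used i (digitStep (comparison v S i) s).2.2 } : Store C).stk := by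
  by_cases h : v.same i = true ∧ (S.lit i).head? = some s
  · simp [compareDigit, hs, h, digitStep, comparison]
  · have h' : (v.same i && decide ((S.lit i).head? = some s)) = false := by simpa using h
    simp [compareDigit, hs, h, h', digitStep, comparison]

theorem update_three {β : Type} (f g : Fin 3 → β) :
    Function.update (Function.update (Function.update f 0 (g 0)) 1 (g 1)) 2 (g 2) = g := by
  funext i
  fin_cases i <;> simp

theorem stepAux_compareDigits (q : TM2.Stmt (Alphabet C) Label (Memory C))
    {v : Memory C} {s : Symbol} (hs : v.cur = some s) (S : Store C) :
    TM2.stepAux (compareDigit 0 <| compareDigit 1 <| compareDigit 2 q) v S.stk = TM2.stepAux q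
      { v with same := fun i => (digitStep (comparison v S i) s).1 }
      ({ S with
          lit := fun i => (digitStep (comparison v S i) s).2.1
          used := fun i => (digitStep (comparison v S i) s).2.2 } : Store C).stk := by
  rw [stepAux_compareDigit (s := s) 0 _ hs, stepAux_compareDigit (s := s) 1,
    stepAux_compareDigit (s := s) 2, ← update_three v.same fun i => (digitStep (comparison v S i) s).1,
    ← update_three S.lit fun i => (digitStep (comparison v S i) s).2.1,
    ← update_three S.used fun i => (digitStep (comparison v S i) s).2.2]
  · rfl
  all_goals exact hs

theorem reaches_compare {w : List Symbol} (hw : ∀ s ∈ w, s.isBit = true) (r : List Symbol)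
    (v : Memory C) (S : Store C) :
    ∃ c, E.Reaches (config .compare v { S with proc := w ++ r })
      (config .compare
        { v with cur := c, same := fun i => (w.foldl digitStep (comparison v S i)).1 }
        { S with
          proc := r
          done := w.reverse ++ S.done
          lit := fun i => (w.foldl digitStep (comparison v S i)).2.1
          used := fun i => (w.foldl digitStep (comparison v S i)).2.2 }) w.length := by
  induction w generalizing v S with
  | nil => exact ⟨v.cur, .refl _⟩
  | cons s w ih =>
    have hs := hw s List.mem_cons_self
    have h₁ := (Evaluator.Reaches.of_step (E := E) (l := .compare) (v := v)
      (S := { S with proc := s :: w ++ r })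
      (c := config .compare
        { v with cur := some s, same := fun i => (digitStep (comparison v S i) s).1 }
        { S with
          proc := w ++ r
          done := s :: S.done
          lit := fun i => (digitStep (comparison v S i) s).2.1
          used := fun i => (digitStep (comparison v S i) s).2.2 })
      (by
        simp only [Evaluator.program, TM2.stepAux, Store.stk_proc, List.cons_append,
          List.head?_cons, Option.any_some, hs, cond_true, List.tail_cons, Store.update_proc,
          Store.stk_done, Store.update_done, Option.getD_some]
        rw [stepAux_compareDigits (s := s) _ rfl]
        rfl))
    obtain ⟨c, h₂⟩ := ih (fun s h => hw s (List.mem_cons_of_mem _ h))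
      { v with cur := some s, same := fun i => (digitStep (comparison v S i) s).1 }
      { S with
          done := s :: S.done
          lit := fun i => (digitStep (comparison v S i) s).2.1
          used := fun i => (digitStep (comparison v S i) s).2.2 }
    refine ⟨c, cast ?_ ((h₁.trans h₂).mono (n := (s :: w).length) (by simp; omega))⟩
    simp [comparison]

theorem reaches_restore (i : Fin 3) (u : List Symbol) (v : Memory C) (S : Store C) :
    E.Reaches (config (.restore i) v { S with used := Function.update S.used i u })
      (config ((nextIndex i).elim .scan .restore) { v with cur := none }
        { S with
          lit := Function.update S.lit i (u.reverse ++ S.lit i)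
          used := Function.update S.used i [] }) (u.length + 1) := by
  induction u generalizing v S with
  | nil => exact (Evaluator.Reaches.of_step (by simp [Evaluator.program, config]))
  | cons s u ih =>
    have := (Evaluator.Reaches.of_step (E := E) (l := .restore i) (v := v)
      (S := { S with used := Function.update S.used i (s :: u) })
      (c := config (.restore i) { v with cur := some s }
        { S with
          lit := Function.update S.lit i (s :: S.lit i)
          used := Function.update S.used i u })
      (by simp [Evaluator.program, config])).trans
      (ih _ { S with lit := Function.update S.lit i (s :: S.lit i) })
    refine cast ?_ (this.mono (n := (s :: u).length + 1) (by simp; omega))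
    simp

theorem reaches_restored (v : Memory C) (S : Store C) :
    E.Reaches (config (.restore 0) v S)
      (config .scan { v with cur := none }
        { S with lit := fun i => (S.used i).reverse ++ S.lit i, used := fun _ => [] })
      ((S.used 0).length + (S.used 1).length + (S.used 2).length + 3) := by
  have h₀ := reaches_restore (E := E) 0 (S.used 0) v S
  have h₁ := reaches_restore (E := E) 1 (S.used 1) { v with cur := none }
    { S with
      lit := Function.update S.lit 0 ((S.used 0).reverse ++ S.lit 0)
      used := Function.update S.used 0 [] }
  have h₂ := reaches_restore (E := E) 2 (S.used 2) { v with cur := none }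
    { S with
      lit := Function.update (Function.update S.lit 0 ((S.used 0).reverse ++ S.lit 0)) 1
        ((S.used 1).reverse ++ S.lit 1)
      used := Function.update (Function.update S.used 0 []) 1 [] }
  have e₁ : Function.update (Function.update S.used 0 []) 1 (S.used 1) =
      Function.update S.used 0 [] := by funext i; fin_cases i <;> simp
  have e₂ : Function.update (Function.update (Function.update S.used 0 []) 1 []) 2 (S.used 2) =
      Function.update (Function.update S.used 0 []) 1 [] := by funext i; fin_cases i <;> simp
  rw [Function.update_eq_self] at h₀
  dsimp only at h₁ h₂
  rw [e₁] at h₁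
  rw [e₂] at h₂
  refine cast ?_ (((h₀.trans h₁).trans h₂).mono
    (n := (S.used 0).length + (S.used 1).length + (S.used 2).length + 3) (by omega))
  rw [← update_three S.used fun _ => [], ← update_three S.lit fun i => (S.used i).reverse ++ S.lit i]
  rfl

theorem Evaluator.Reaches.congr {c : TM2.Cfg (Alphabet C) Label (Memory C)} {l : Label}
    {v : Memory C} {S S' : Store C} {m n : ℕ} (h : E.Reaches c (config l v S) m) (hS : S = S')
    (hmn : m ≤ n) : E.Reaches c (config l v S') n :=
  hS ▸ h.mono hmn

/-! ### Reading tasks -/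

/-- Records the occurrence of a literal in an annotation. -/
def Obligation.mark (o : Obligation) (l : Literal) (x : Letter) : Letter :=
  fun i b => x i b || decide ((o.lit i).atom = l.atom ∧ ((o.lit i).positive == l.positive) = b)

/-- The annotation is read from its last literal, hence the right fold; starting from the empty
letter it yields the letter of the task. -/
theorem Obligation.foldr_mark (o : Obligation) (ls : List Literal) :
    ls.foldr o.mark (fun _ _ => false) =
      fun i b => decide (⟨(o.lit i).atom, (o.lit i).positive == b⟩ ∈ ls) := by
  induction ls with
  | nil => simp
  | cons l ls ih =>
    funext i b
    rw [List.foldr_cons, ih, Obligation.mark, ← Bool.decide_or, decide_eq_decide, List.mem_cons,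
      or_comm]
    obtain ⟨a, p⟩ := l
    simp only [Literal.mk.injEq]
    generalize (o.lit i).positive = q
    exact or_congr_left (and_congr_right fun _ => by revert p q b; decide)

/-- The memory keeps the obligation and the answer. -/
structure Memory.Agrees (v' v : Memory C) : Prop where
  ach : v'.ach = v.ach
  sign : v'.sign = v.sign
  ok : v'.ok = v.ok

theorem Memory.Agrees.trans {v₁ v₂ v₃ : Memory C} (h : v₁.Agrees v₂) (h' : v₂.Agrees v₃) :
    v₁.Agrees v₃ :=
  ⟨h.ach.trans h'.ach, h.sign.trans h'.sign, h.ok.trans h'.ok⟩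

theorem Obligation.Loaded.of_agrees {o : Obligation} {v v' : Memory C} (h : o.Loaded v)
    (h' : v'.Agrees v) : o.Loaded v' :=
  ⟨h'.ach.trans h.ach, h'.sign.trans h.sign⟩

/-- With `n` digits, the sign takes one step, the comparison `n`, the record of the result one, and
restoring three atoms at most `3 * n + 3`; the total is at most `5 * (n + 1)`. The condition on `r`
makes the comparison stop after the last digit of `l`. -/
theorem reaches_literal {o : Obligation} {v : Memory C} (hv : o.Loaded v) (l : Literal)
    (inp : List Symbol) {r : List Symbol} (hr : r.head?.any Symbol.isBit = false)
    (done : List Symbol) (F : List (Op × Option C)) :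
    ∃ v' : Memory C, E.Reaches
      (config .scan v (o.scanStore inp (l.encode.reverse ++ r) done F))
      (config .scan v' (o.scanStore inp r (l.encode ++ done) F)) (5 * l.encode.length) ∧
      v'.Agrees v ∧ v'.acc = v.acc ∧ v'.letter = o.mark l v.letter := by
  set w := l.digits.reverse with hw
  have h₁ : E.Reaches (config .scan v (o.scanStore inp (l.encode.reverse ++ r) done F))
      (config .compare
        { v with cur := some (.lit l.positive), pos := l.positive, same := fun _ => true }
        (o.scanStore inp (w ++ r) (.lit l.positive :: done) F)) 1 := by
    refine Evaluator.Reaches.of_step ?_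
    rw [l.encode_eq]
    cases l.positive <;> simp [Evaluator.program, Evaluator.read, Obligation.scanStore, config,
      Symbol.closes, Symbol.isOpen, hw]
  obtain ⟨c, h₂⟩ := reaches_compare (E := E) (w := w)
    (fun s hs => Literal.isBit_of_mem_digits (List.mem_reverse.1 hs)) r
    { v with cur := some (.lit l.positive), pos := l.positive, same := fun _ => true }
    (o.scanStore inp [] (.lit l.positive :: done) F)
  set y : Fin 3 → Bool × List Symbol × List Symbol :=
    fun i => w.foldl digitStep (true, o.atoms i, []) with hy
  have h₃ : E.Reaches
      (config .compare { v with cur := c, pos := l.positive, same := fun i => (y i).1 }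
        ⟨inp, [], r, w.reverse ++ .lit l.positive :: done, F,
          fun i => (y i).2.1, fun i => (y i).2.2⟩)
      (config (.restore 0)
        { v with
          cur := r.head?
          pos := l.positive
          same := fun i => (y i).1
          letter := o.mark l v.letter }
        ⟨inp, [], r, w.reverse ++ .lit l.positive :: done, F,
          fun i => (y i).2.1, fun i => (y i).2.2⟩) 1 := by
    refine Evaluator.Reaches.of_step ?_
    have key (i : Fin 3) : ((y i).1 = true ∧ (y i).2.1.head? = none) ↔
        (o.lit i).atom = l.atom := by
      rw [List.head?_eq_none_iff, hy, foldl_digitStep_iff, ← Literal.digits_eq_iff]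
      simp [Obligation.atoms, hw]
    simp only [Evaluator.program, TM2.stepAux, Store.stk_proc, hr, cond_false, recordMatch,
      Store.stk_lit, config, TM2.Cfg.mk.injEq, Memory.mk.injEq, true_and, and_true]
    funext i b
    rw [Bool.eq_iff_iff]
    simp only [Obligation.mark, Bool.or_eq_true, decide_eq_true_eq, ← key i, hv.sign]
    fin_cases i <;> simp [and_assoc]
  have h₄ := reaches_restored (E := E)
    { v with
      cur := r.head?
      pos := l.positive
      same := fun i => (y i).1
      letter := o.mark l v.letter }
    ⟨inp, [], r, w.reverse ++ .lit l.positive :: done, F, fun i => (y i).2.1, fun i => (y i).2.2⟩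
  have hl (i : Fin 3) : (y i).2.2.length ≤ w.length :=
    (foldl_digitStep_length w _).trans (by simp)
  have ha : (fun i => (y i).2.2.reverse ++ (y i).2.1) = o.atoms :=
    funext fun i => foldl_digitStep_append w _
  dsimp only at h₄
  rw [ha] at h₄
  refine ⟨_, (((h₁.trans h₂).trans h₃).trans h₄).congr ?_ ?_,
    ⟨rfl, rfl, rfl⟩, rfl, rfl⟩
  · simp [hw, l.encode_eq, Obligation.scanStore]
  · have := hl 0
    have := hl 1
    have := hl 2
    have : l.encode.length = w.length + 1 := by simp [hw, l.encode_eq]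
    omega

theorem reaches_literals {o : Obligation} {v : Memory C} (hv : o.Loaded v) (ls : List Literal)
    (inp : List Symbol) {r : List Symbol} (hr : r.head?.any Symbol.isBit = false)
    (done : List Symbol) (F : List (Op × Option C)) :
    ∃ v' : Memory C, E.Reaches
      (config .scan v (o.scanStore inp ((ls.flatMap Literal.encode).reverse ++ r) done F))
      (config .scan v' (o.scanStore inp r (ls.flatMap Literal.encode ++ done) F))
      (5 * (ls.flatMap Literal.encode).length) ∧
      v'.Agrees v ∧ v'.acc = v.acc ∧ v'.letter = ls.foldr o.mark v.letter := by
  induction ls generalizing r with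
  | nil => exact ⟨v, .refl _, ⟨rfl, rfl, rfl⟩, rfl, rfl⟩
  | cons l ls ih =>
    obtain ⟨v₁, h₁, a₁, c₁, x₁⟩ := ih (r := l.encode.reverse ++ r)
      (by simp [l.encode_eq, Symbol.isBit])
    obtain ⟨v₂, h₂, a₂, c₂, x₂⟩ := reaches_literal (E := E) (hv.of_agrees a₁) l inp hr
      (ls.flatMap Literal.encode ++ done) F
    rw [List.flatMap_cons, List.reverse_append, List.append_assoc, List.append_assoc,
      List.length_append]
    exact ⟨v₂, (h₁.trans h₂).mono (by omega), a₂.trans a₁, c₂.trans c₁, by rw [x₂, x₁]; rfl⟩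

theorem reaches_task {o : Obligation} {v : Memory C} (hv : o.Loaded v) (t : Task)
    (inp r done : List Symbol) (F : List (Op × Option C)) :
    ∃ v' : Memory C, E.Reaches
      (config .scan v (o.scanStore inp (t.encode.reverse ++ r) done F))
      (config .scan v' (o.scanStore inp r (t.encode ++ done) F)) (5 * t.encode.length) ∧
      v'.Agrees v ∧ v'.acc = E.join v.acc (some (E.leaf o.isAchievement (o.letter t))) := by
  set w := t.ann.flatMap Literal.encode with hw
  have h₁ : E.Reaches (config .scan v (o.scanStore inp (t.encode.reverse ++ r) done F))
      (config .scan { v with cur := some .taskClose, letter := fun _ _ => false }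
        (o.scanStore inp (w.reverse ++ .taskOpen :: r) (.taskClose :: done) F)) 1 := by
    refine Evaluator.Reaches.of_step ?_
    simp [Evaluator.program, Evaluator.read, Obligation.scanStore, config, Symbol.closes,
      Symbol.isOpen, Task.encode, hw]
  obtain ⟨v₂, h₂, a₂, c₂, x₂⟩ := reaches_literals (E := E)
    (v := { v with cur := some .taskClose, letter := fun _ _ => false }) ⟨hv.ach, hv.sign⟩ t.ann
    inp (r := .taskOpen :: r) rfl (.taskClose :: done) F
  have h₃ : E.Reaches (config .scan v₂ (o.scanStore inp (.taskOpen :: r) (w ++ .taskClose :: done) F))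
      (config .scan
        { v₂ with cur := some .taskOpen, acc := E.join v₂.acc (some (E.leaf v₂.ach v₂.letter)) }
        (o.scanStore inp r (.taskOpen :: (w ++ .taskClose :: done)) F)) 1 := by
    refine Evaluator.Reaches.of_step ?_
    simp [Evaluator.program, Evaluator.read, Obligation.scanStore, config, Symbol.closes,
      Symbol.isOpen]
  refine ⟨_, ((h₁.trans h₂).trans h₃).congr ?_ ?_,
    ⟨a₂.ach, a₂.sign, a₂.ok⟩, ?_⟩
  · simp [Task.encode, hw]
  · simp only [Task.encode, List.length_cons, List.length_append, List.length_nil, ← hw]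
    omega
  · simp only [c₂, a₂.ach, hv.ach, x₂, o.foldr_mark]
    rfl

/-! ### Reading blocks -/

/-- The value of a block. -/
def Evaluator.eval (E : Evaluator C) (o : Obligation) (B : Block) : C :=
  B.eval (fun t => E.leaf o.isAchievement (o.letter t)) E.op

/-- The value of a sequence of blocks. -/
def Evaluator.evals (E : Evaluator C) (o : Obligation) (Bs : Blocks) (k : Op) : C :=
  Bs.eval (fun t => E.leaf o.isAchievement (o.letter t)) E.op k

/-- The closing bracket, met first, saves the accumulator of the surrounding block as a frame; the
opening bracket restores it and joins the value of the finished block to it. -/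
theorem reaches_composite {o : Obligation} {v : Memory C} (hv : o.Loaded v) (Bs : Blocks) (k : Op)
    {s s' : Symbol} (hs : s.isOpen = true) (hs' : s'.closes = some k)
    (inp r done : List Symbol) (F : List (Op × Option C))
    (h : ∀ (v : Memory C) (r done : List Symbol) (F : List (Op × Option C)), o.Loaded v →
      v.acc = (k, none) → ∃ v' : Memory C, E.Reaches
        (config .scan v (o.scanStore inp (Bs.encode.reverse ++ r) done F))
        (config .scan v' (o.scanStore inp r (Bs.encode ++ done) F)) (5 * Bs.encode.length) ∧
        v'.Agrees v ∧ v'.acc = (k, some (E.evals o Bs k))) :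
    ∃ v' : Memory C, E.Reaches
      (config .scan v (o.scanStore inp ((s :: (Bs.encode ++ [s'])).reverse ++ r) done F))
      (config .scan v' (o.scanStore inp r ((s :: (Bs.encode ++ [s'])) ++ done) F))
      (5 * (s :: (Bs.encode ++ [s'])).length) ∧
      v'.Agrees v ∧ v'.acc = E.join v.acc (some (E.evals o Bs k)) := by
  have h₁ : E.Reaches
      (config .scan v (o.scanStore inp ((s :: (Bs.encode ++ [s'])).reverse ++ r) done F))
      (config .scan { v with cur := some s', acc := (k, none) }
        (o.scanStore inp (Bs.encode.reverse ++ s :: r) (s' :: done) (v.acc :: F))) 1 := by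
    refine Evaluator.Reaches.of_step ?_
    simp [Evaluator.program, Obligation.scanStore, config, hs']
  obtain ⟨v₂, h₂, a₂, c₂⟩ := h { v with cur := some s', acc := (k, none) } (s :: r) (s' :: done)
    (v.acc :: F) ⟨hv.ach, hv.sign⟩ rfl
  have h₃ : E.Reaches
      (config .scan v₂ (o.scanStore inp (s :: r) (Bs.encode ++ s' :: done) (v.acc :: F)))
      (config .scan { v₂ with cur := some s, acc := E.join v.acc v₂.acc.2 }
        (o.scanStore inp r (s :: (Bs.encode ++ s' :: done)) F)) 1 := by
    refine Evaluator.Reaches.of_step ?_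
    have : s.closes = none := by cases s <;> simp_all [Symbol.isOpen, Symbol.closes]
    simp [Evaluator.program, Obligation.scanStore, config, hs, this]
  refine ⟨_, ((h₁.trans h₂).trans h₃).congr ?_ ?_, ⟨a₂.ach, a₂.sign, a₂.ok⟩, ?_⟩
  · simp
  · simp; omega
  · simp only [c₂]

mutual
theorem reaches_block {o : Obligation} (inp : List Symbol) :
    ∀ (B : Block) (v : Memory C) (r done : List Symbol) (F : List (Op × Option C)), o.Loaded v →
      ∃ v' : Memory C, E.Reaches
        (config .scan v (o.scanStore inp (B.encode.reverse ++ r) done F))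
        (config .scan v' (o.scanStore inp r (B.encode ++ done) F)) (5 * B.encode.length) ∧
        v'.Agrees v ∧ v'.acc = E.join v.acc (some (E.eval o B))
  | .task t, v, r, done, F, hv => by
    simpa only [Block.encode, Evaluator.eval, Block.eval] using reaches_task hv t inp r done F
  | .seq Bs, v, r, done, F, hv => by
    simpa only [Block.encode, Evaluator.eval, Evaluator.evals, Block.eval] using
      reaches_composite hv Bs .seq rfl rfl inp r done F (reaches_blocks inp Bs .seq)
  | .xor Bs, v, r, done, F, hv => by
    simpa only [Block.encode, Evaluator.eval, Evaluator.evals, Block.eval] using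
      reaches_composite hv Bs .xor rfl rfl inp r done F (reaches_blocks inp Bs .xor)
  | .and Bs, v, r, done, F, hv => by
    simpa only [Block.encode, Evaluator.eval, Evaluator.evals, Block.eval] using
      reaches_composite hv Bs .and rfl rfl inp r done F (reaches_blocks inp Bs .and)
theorem reaches_blocks {o : Obligation} (inp : List Symbol) :
    ∀ (Bs : Blocks) (k : Op) (v : Memory C) (r done : List Symbol) (F : List (Op × Option C)),
      o.Loaded v → v.acc = (k, none) → ∃ v' : Memory C, E.Reaches
        (config .scan v (o.scanStore inp (Bs.encode.reverse ++ r) done F))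
        (config .scan v' (o.scanStore inp r (Bs.encode ++ done) F)) (5 * Bs.encode.length) ∧
        v'.Agrees v ∧ v'.acc = (k, some (E.evals o Bs k))
  | .pair B₁ B₂, k, v, r, done, F, hv, hk => by
    obtain ⟨v₂, h₂, a₂, c₂⟩ := reaches_block inp B₂ v (B₁.encode.reverse ++ r) done F hv
    obtain ⟨v₁, h₁, a₁, c₁⟩ := reaches_block inp B₁ v₂ r (B₂.encode ++ done) F (hv.of_agrees a₂)
    rw [Blocks.encode, List.reverse_append, List.append_assoc, List.append_assoc,
      List.length_append]
    refine ⟨v₁, (h₂.trans h₁).mono (by omega), a₁.trans a₂, ?_⟩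
    rw [c₁, c₂, hk]
    simp only [Evaluator.join, Evaluator.evals, Evaluator.eval, Blocks.eval]
  | .cons B Bs, k, v, r, done, F, hv, hk => by
    obtain ⟨v₂, h₂, a₂, c₂⟩ := reaches_blocks inp Bs k v (B.encode.reverse ++ r) done F hv hk
    obtain ⟨v₁, h₁, a₁, c₁⟩ := reaches_block inp B v₂ r (Bs.encode ++ done) F (hv.of_agrees a₂)
    rw [Blocks.encode, List.reverse_append, List.append_assoc, List.append_assoc,
      List.length_append]
    refine ⟨v₁, (h₂.trans h₁).mono (by omega), a₁.trans a₂, ?_⟩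
    rw [c₁, c₂]
    simp only [Evaluator.join, Evaluator.evals, Evaluator.eval, Blocks.eval]
end

/-! ### The loop over the obligations -/

theorem reaches_rewind (w : List Symbol) (v : Memory C) (S : Store C) :
    E.Reaches (config .rewind v { S with done := w })
      (config (.clear 0) { v with cur := none } { S with proc := w.reverse ++ S.proc, done := [] })
      (w.length + 1) := by
  induction w generalizing v S with
  | nil => exact (Evaluator.Reaches.of_step (by simp [Evaluator.program, config]))
  | cons s w ih =>
    have := (Evaluator.Reaches.of_step (E := E) (l := .rewind) (v := v)
      (S := { S with done := s :: w })
      (c := config .rewind { v with cur := some s } { S with proc := s :: S.proc, done := w })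
      (by simp [Evaluator.program, config])).trans (ih _ { S with proc := s :: S.proc })
    refine cast ?_ (this.mono (n := (s :: w).length + 1) (by simp; omega))
    simp

theorem reaches_clear (i : Fin 3) (w : List Symbol) (v : Memory C) (S : Store C) :
    E.Reaches (config (.clear i) v { S with lit := Function.update S.lit i w })
      (config ((nextIndex i).elim .main .clear) { v with cur := none }
        { S with lit := Function.update S.lit i [] }) (w.length + 1) := by
  induction w generalizing v S with
  | nil => exact (Evaluator.Reaches.of_step (by simp [Evaluator.program, config]))
  | cons s w ih =>
    have := (Evaluator.Reaches.of_step (E := E) (l := .clear i) (v := v)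
      (S := { S with lit := Function.update S.lit i (s :: w) })
      (c := config (.clear i) { v with cur := some s }
        { S with lit := Function.update S.lit i w })
      (by simp [Evaluator.program, config])).trans (ih _ S)
    exact this.mono (n := (s :: w).length + 1) (by simp; omega)

theorem reaches_cleared (v : Memory C) (S : Store C) :
    E.Reaches (config (.clear 0) v S)
      (config .main { v with cur := none } { S with lit := fun _ => [] })
      ((S.lit 0).length + (S.lit 1).length + (S.lit 2).length + 3) := by
  have h₀ := reaches_clear (E := E) 0 (S.lit 0) v S
  have h₁ := reaches_clear (E := E) 1 (S.lit 1) { v with cur := none }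
    { S with lit := Function.update S.lit 0 [] }
  have h₂ := reaches_clear (E := E) 2 (S.lit 2) { v with cur := none }
    { S with lit := Function.update (Function.update S.lit 0 []) 1 [] }
  have e₁ : Function.update (Function.update S.lit 0 []) 1 (S.lit 1) =
      Function.update S.lit 0 [] := by funext i; fin_cases i <;> simp
  have e₂ : Function.update (Function.update (Function.update S.lit 0 []) 1 []) 2 (S.lit 2) =
      Function.update (Function.update S.lit 0 []) 1 [] := by funext i; fin_cases i <;> simp
  rw [Function.update_eq_self] at h₀
  dsimp only at h₁ h₂
  rw [e₁] at h₁
  rw [e₂] at h₂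
  refine cast ?_ (((h₀.trans h₁).trans h₂).mono
    (n := (S.lit 0).length + (S.lit 1).length + (S.lit 2).length + 3) (by omega))
  rw [← update_three S.lit fun _ => []]
  rfl

theorem Obligation.length_encode (o : Obligation) : o.encode.length =
    (o.atoms 0).length + (o.atoms 1).length + (o.atoms 2).length + 4 := by
  simp [Obligation.encode, Literal.encode_eq, Obligation.atoms, Obligation.lit]
  omega

/-- Whether a block complies with the obligation, according to its value. -/
def Evaluator.accepts (E : Evaluator C) (B : Block) (o : Obligation) : Bool :=
  !E.rejects o.isAchievement (E.eval o B)

theorem reaches_obligation (B : Block) (o : Obligation) (r : List Symbol) (v : Memory C) :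
    ∃ v' : Memory C, E.Reaches
      (config .main v (mainStore (o.encode ++ r) B.encode.reverse))
      (config .main v' (mainStore r B.encode.reverse))
      (2 * o.encode.length + 6 * B.encode.length + 1) ∧ v'.ok = (v.ok && E.accepts B o) := by
  obtain ⟨v₁, h₁, l₁, k₁, c₁⟩ := reaches_obligation_loaded (E := E) o r B.encode.reverse v
  obtain ⟨v₂, h₂, a₂, c₂⟩ := reaches_block (E := E) r B v₁ [] [] [] l₁
  rw [c₁] at c₂
  simp only [List.append_nil] at h₂
  have h₃ : E.Reaches (config .scan v₂ (o.scanStore r [] B.encode []))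
      (config .rewind { v₂ with cur := none, ok := v.ok && E.accepts B o }
        ⟨r, [], [], B.encode, [], o.atoms, fun _ => []⟩) 1 := by
    refine Evaluator.Reaches.of_step ?_
    simp [Evaluator.program, Obligation.scanStore, config, c₂, Evaluator.join, a₂.ok, k₁, a₂.ach,
      l₁.ach, Evaluator.accepts]
  have h₄ := reaches_rewind (E := E) B.encode
    { v₂ with cur := none, ok := v.ok && E.accepts B o }
    ⟨r, [], [], [], [], o.atoms, fun _ => []⟩
  simp only [List.append_nil] at h₄
  have h₅ := reaches_cleared (E := E) { v₂ with cur := none, ok := v.ok && E.accepts B o }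
    ⟨r, [], B.encode.reverse, [], [], o.atoms, fun _ => []⟩
  have h₆ := (h₁.trans h₂).trans (h₃.trans (h₄.trans h₅))
  refine ⟨_, h₆.mono ?_, rfl⟩
  have := o.length_encode
  dsimp only
  omega

theorem reaches_obligations (B : Block) (os : List Obligation) (v : Memory C) :
    ∃ v' : Memory C, E.Reaches
      (config .main v (mainStore (os.flatMap Obligation.encode) B.encode.reverse))
      (config .main v' (mainStore [] B.encode.reverse))
      ((os.flatMap Obligation.encode).length * (6 * B.encode.length + 3)) ∧
      v'.ok = (v.ok && os.all (E.accepts B)) := by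
  induction os generalizing v with
  | nil => exact ⟨v, .mono (.refl _) (Nat.zero_le _), by simp⟩
  | cons o os ih =>
    obtain ⟨v₁, h₁, e₁⟩ := reaches_obligation (E := E) B o (os.flatMap Obligation.encode) v
    obtain ⟨v₂, h₂, e₂⟩ := ih v₁
    refine ⟨v₂, (h₁.trans h₂).mono ?_, ?_⟩
    · have := o.length_encode
      rw [List.flatMap_cons, List.length_append, add_mul]
      -- An obligation has a nonempty code, so its length can pay for one full pass over the
      -- process.
      have h : 1 * (6 * B.encode.length + 3) ≤ o.encode.length * (6 * B.encode.length + 3) :=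
        Nat.mul_le_mul_right _ (by omega)
      nlinarith
    · rw [e₂, e₁, List.all_cons, Bool.and_assoc]

/-- A halting configuration must have the initial memory and only the output on its stacks, so the
process is erased and the memory reset. -/
theorem reaches_finish (w : List Symbol) (v : Memory C) (S : Store C) :
    E.Reaches (config .finish v { S with proc := w })
      ⟨none, Memory.init, ({ S with proc := [], out := v.ok :: S.out } : Store C).stk⟩
      (w.length + 1) := by
  induction w generalizing v S with
  | nil => exact (Evaluator.Reaches.of_step (by simp [Evaluator.program]))
  | cons s w ih =>
    exact ((Evaluator.Reaches.of_step (E := E) (l := .finish) (v := v)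
      (S := { S with proc := s :: w })
      (c := config .finish { v with cur := some s } { S with proc := w })
      (by simp [Evaluator.program, config])).trans (ih _ S)).mono (by simp; omega)

mutual
theorem Block.isObl_of_mem_encode :
    ∀ (B : Block) (s : Symbol), s ∈ B.encode → s.isObl = false
  | .task t, s => by
    simp only [Block.encode, Task.encode, List.mem_cons, List.mem_append, List.mem_flatMap,
      Literal.encode, List.mem_map, List.not_mem_nil, or_false]
    rintro (rfl | ⟨l, -, ⟨b, -, rfl⟩ | rfl⟩ | rfl) <;> rfl
  | .seq Bs, s => by
    simp only [Block.encode, List.mem_cons, List.mem_append, List.not_mem_nil, or_false]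
    rintro (rfl | h | rfl)
    exacts [rfl, Bs.isObl_of_mem_encode s h, rfl]
  | .xor Bs, s => by
    simp only [Block.encode, List.mem_cons, List.mem_append, List.not_mem_nil, or_false]
    rintro (rfl | h | rfl)
    exacts [rfl, Bs.isObl_of_mem_encode s h, rfl]
  | .and Bs, s => by
    simp only [Block.encode, List.mem_cons, List.mem_append, List.not_mem_nil, or_false]
    rintro (rfl | h | rfl)
    exacts [rfl, Bs.isObl_of_mem_encode s h, rfl]
theorem Blocks.isObl_of_mem_encode :
    ∀ (Bs : Blocks) (s : Symbol), s ∈ Bs.encode → s.isObl = false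
  | .pair B₁ B₂, s => by
    rw [Blocks.encode, List.mem_append]
    exact fun h => h.elim (B₁.isObl_of_mem_encode s) (B₂.isObl_of_mem_encode s)
  | .cons B Bs, s => by
    rw [Blocks.encode, List.mem_append]
    exact fun h => h.elim (B.isObl_of_mem_encode s) (Bs.isObl_of_mem_encode s)
end

/-- The quadratic bound comes from one pass over the process per obligation; the initial transfer
and the final erasure are linear. -/
theorem reaches_halt (x : ProcessModel × List Obligation) :
    E.Reaches (config .split Memory.init (mainStore (encodeInstance x) []))
      ⟨none, Memory.init, (⟨[], [x.2.all (E.accepts x.1.block)], [], [], [], fun _ => [],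
        fun _ => []⟩ : Store C).stk⟩ (9 * ((encodeInstance x).length + 1) ^ 2) := by
  obtain ⟨P, os⟩ := x
  have h₁ := reaches_split (E := E) (r := os.flatMap Obligation.encode)
    P.block.isObl_of_mem_encode (by cases os <;> simp [Obligation.encode, Symbol.isObl])
    Memory.init (mainStore [] [])
  obtain ⟨v₂, h₂, e₂⟩ := reaches_obligations (E := E) P.block os
    { Memory.init with cur := (os.flatMap Obligation.encode).head? }
  have h₃ : E.Reaches (config .main v₂ (mainStore [] P.block.encode.reverse))
      (config .finish { v₂ with cur := none } (mainStore [] P.block.encode.reverse)) 1 :=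
    Evaluator.Reaches.of_step (by simp [Evaluator.program, config, mainStore])
  have h₄ := reaches_finish (E := E) P.block.encode.reverse { v₂ with cur := none }
    (mainStore [] [])
  simp only [mainStore, List.append_nil] at h₁
  have h₅ := h₁.trans (h₂.trans (h₃.trans h₄))
  refine cast ?_ (h₅.mono (n := 9 * ((encodeInstance (P, os)).length + 1) ^ 2) ?_)
  · simp [e₂, Memory.init, mainStore, encodeInstance, ProcessModel.encode]
  · simp only [encodeInstance, ProcessModel.encode, List.length_append, List.length_reverse]
    nlinarith

theorem initList_machine [Finite C] (w : List Symbol) :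
    initList E.machine w = config .split Memory.init (mainStore w []) := by
  refine congrArg (TM2.Cfg.mk _ _) (funext fun k => ?_)
  cases k <;> rfl

theorem haltList_machine [Finite C] (w : List Bool) :
    haltList E.machine w =
      ⟨none, Memory.init, (⟨[], w, [], [], [], fun _ => [], fun _ => []⟩ : Store C).stk⟩ := by
  refine congrArg (TM2.Cfg.mk _ _) (funext fun k => ?_)
  cases k <;> rfl

/-- A problem that is decided by evaluating the block in a finite algebra is in `P`. -/
theorem inP_of_evaluator [Finite C] (E : Evaluator C) {p : ProcessModel × List Obligation → Prop}
    (hp : ∀ x, p x ↔ ∀ o ∈ x.2, E.rejects o.isAchievement (E.eval o x.1.block) = false) :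
    InP encodeInstance p := by
  classical
  refine ⟨{
    tm := E.machine
    inputAlphabet := Equiv.refl _
    outputAlphabet := Equiv.refl _
    time := 9 * (Polynomial.X + 1) ^ 2
    outputsFun := fun x => ?_ }⟩
  have h := (reaches_halt (E := E) x).some
  have e : decide (p x) = x.2.all (E.accepts x.1.block) := by
    rw [Bool.eq_iff_iff, decide_eq_true_iff, hp, List.all_eq_true]
    simp [Evaluator.accepts]
  refine cast ?_ h
  rw [TM2OutputsInTime]
  congr 1
  · exact (congrArg _ (List.map_id _)).trans (initList_machine _) |>.symm
  · refine congrArg some ((congrArg _ (List.map_id _)).trans ?_).symm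
    rw [e]
    exact haltList_machine _
  · simp

end Program

end BusinessProcess

theorem mainTheorem1 :
    BusinessProcess.InP BusinessProcess.encodeInstance
      (fun x : BusinessProcess.ProcessModel × List BusinessProcess.Obligation =>
        BusinessProcess.FullyCompliant x.1 x.2) := by
  classical
  -- The algebra of profiles is finite and independent of the instance, so its operations and the
  -- test for violation are fixed finite tables of the machine; choosing them classically costs no
  -- running time.
  exact BusinessProcess.inP_of_evaluator
    ⟨BusinessProcess.taskProfile, BusinessProcess.profileOp,
      fun ach N => decide (BusinessProcess.Profile.Violates ach N)⟩
    fun x => (BusinessProcess.fullyCompliant_iff x.1 x.2).trans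
      (forall₂_congr fun _ _ => decide_eq_false_iff_not.symm)
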